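/- Let $0<\alpha<2$. There is a constant $B_\alpha>0$, depending only on $\alpha$, with the following property. Let $\omega$ be a modulus of continuity, i.e. a continuous, non-decreasing, concave function on $[0,\infty)$ with $\omega(0)=0$, and let $\theta:\mathbb{R}^2\to\mathbb{R}$ have modulus of continuity $\omega$, i.e. $|\theta(x')-\theta(y')|\le\omega(|x'-y'|)$ for all $x',y'\in\mathbb{R}^2$. Let $|D|^\alpha=(-\Delta)^{\alpha/2}$ be the Fourier multiplier with symbol $|\zeta|^\alpha$. Assume that $\int_{\mathbb{R}^2}|\theta(z)|(1+|z|)^{-2-\alpha}\,\mathrm{d}z<\infty$, so that $|D|^\alpha\theta$ is defined as a tempered distribution by $\langle|D|^\alpha\theta,\varphi\rangle=\int_{\mathbb{R}^2}\theta\,|D|^\alpha\varphi\,\mathrm{d}z$ for Schwartz functions $\varphi$, and that it is given by a function, again denoted $|D|^\alpha\theta$, whose product with every Schwartz function is integrable. Suppose that $\theta(x)-\theta(y)=\omega(\xi)$ at some $x,y\in\mathbb{R}^2$ with $|x-y|=\xi>0$, and that $|D|^\alpha\theta$ is continuous at $x$ and at $y$. Then the integrals $$I_1=\int_0^{\xi/2}\frac{\omega(\xi+2\eta)+\omega(\xi-2\eta)-2\omega(\xi)}{\eta^{1+\alpha}}\,\mathrm{d}\eta,\qquad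 I_2=\int_{\xi/2}^\infty\frac{\omega(2\eta+\xi)-\omega(2\eta-\xi)-2\omega(\xi)}{\eta^{1+\alpha}}\,\mathrm{d}\eta$$ converge absolutely, and $$\bigl[-|D|^\alpha\theta\bigr](x)-\bigl[-|D|^\alpha\theta\bigr](y)\le B_\alpha I_1+B_\alpha I_2 .$$ Moreover $I_1\le0$ and $I_2\le0$; $I_1<0$ unless $\omega(s)=\frac{\omega(\xi)}{\xi}s$ for all $s\in[0,2\xi]$, and $I_2<0$ unless $\omega(s)=\frac{\omega(\xi)}{\xi}s$ for all $s\ge0$. In particular both are strictly negative if $\omega$ is strictly concave. -/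

import Mathlib

open scoped FourierTransform SchwartzMap
open MeasureTheory

/-- A modulus of continuity: a continuous, increasing (in the weak sense), concave function on
`[0, ∞)` that vanishes at `0`. Values at negative reals are irrelevant. -/
structure IsModulus (ω : ℝ → ℝ) : Prop where
  continuousOn : ContinuousOn ω (Set.Ici 0)
  monotoneOn : MonotoneOn ω (Set.Ici 0)
  concaveOn : ConcaveOn ℝ (Set.Ici 0) ω
  map_zero : ω 0 = 0

/-- The function `θ` on the plane has modulus of continuity `ω`. -/
def HasModulus (θ : EuclideanSpace ℝ (Fin 2) → ℝ) (ω : ℝ → ℝ) : Prop :=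
  ∀ x y, |θ x - θ y| ≤ ω ‖x - y‖

/-- `|D|^α φ` for a Schwartz function `φ` on the plane: the Fourier multiplier with symbol `|ζ|^α`.
Mathlib's Fourier transform has the kernel `exp (-2πi⟨z, ζ⟩)`, so that the symbol of
`|D|^α = (-Δ)^(α/2)` reads `(2π|ζ|)^α`. -/
noncomputable def fracLapSchwartz (α : ℝ) (φ : 𝓢(EuclideanSpace ℝ (Fin 2), ℂ)) :
    EuclideanSpace ℝ (Fin 2) → ℂ :=
  𝓕⁻ (fun ζ : EuclideanSpace ℝ (Fin 2) =>
    (((2 * Real.pi * ‖ζ‖) ^ α : ℝ) : ℂ) * 𝓕 (φ : EuclideanSpace ℝ (Fin 2) → ℂ) ζ)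

/-- `|D|^α θ = g` in the sense of tempered distributions, i.e. the Fourier transform of `g` is
`|ζ|^α` times that of `θ`, expressed by duality with Schwartz functions:
`∫ θ |D|^α φ = ∫ g φ` for every `φ`.
As `|D|^α φ` decays like `|z|^(-2-α)`, the left side makes sense exactly for those `θ` that are
integrable against the weight `(1 + |z|)^(-(2+α))`. -/
structure IsFracLap (α : ℝ) (θ g : EuclideanSpace ℝ (Fin 2) → ℝ) : Prop where
  integrable_weight : Integrable (fun z => θ z * (1 + ‖z‖) ^ (-(2 + α))) volume
  integrable_mul : ∀ φ : 𝓢(EuclideanSpace ℝ (Fin 2), ℂ),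
    Integrable (fun z => (g z : ℂ) * φ z) volume
  integral_eq : ∀ φ : 𝓢(EuclideanSpace ℝ (Fin 2), ℂ),
    ∫ z, (θ z : ℂ) * fracLapSchwartz α φ z = ∫ z, (g z : ℂ) * φ z

/-- The integrand of the first integral, on `(0, ξ/2)`. -/
noncomputable def nearIntegrand (α : ℝ) (ω : ℝ → ℝ) (ξ η : ℝ) : ℝ :=
  (ω (ξ + 2 * η) + ω (ξ - 2 * η) - 2 * ω ξ) / η ^ (1 + α)

/-- The integrand of the second integral, on `(ξ/2, ∞)`. -/
noncomputable def farIntegrand (α : ℝ) (ω : ℝ → ℝ) (ξ η : ℝ) : ℝ :=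
  (ω (2 * η + ξ) - ω (2 * η - ξ) - 2 * ω ξ) / η ^ (1 + α)

/-! Put `β = α/2`, so that `|D|^α = (-Δ)^β` is subordinate to the heat semigroup. Formally, `|D|^α
θ` is a constant times `∫ (θ - e^{τΔ}θ) τ^(-1-β) dτ`. Taking the difference at `x` and `y` and using
`θ x - θ y = ω ξ`, one gets for `g x - g y` a positive constant times the integral of `N(τ)
τ^(-1-β)`, where `N(τ)` is the deficit of `(e^{τΔ}θ)(x) - (e^{τΔ}θ)(y)` from `ω ξ`. Two things are
needed: a lower bound for `N`, and a substitute for the formal identity, since `θ` has no regularity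
beyond its modulus.

Lower bound. The planar heat kernel is a product of Gaussians along and across `x - y`, so it
suffices to bound Gaussian-averaged increments on a line. Centre the line at the midpoint of `x` and
`y`. The difference of two Gaussians centred at `±ξ/2` is odd and nonnegative on the right, so only
the odd part of the function counts, and that part is at most `ω(2v)/2` at `v ≥ 0`. Hence the odd
function with these values is extremal (`IsModulus.heatLine_increment_le`), and its average is `ω ξ
+ ∫ heatLine τ u * modulusGap ω ξ u du` over `u > 0` (`IsModulus.heatLine_oddProfile`). Integrating
in `τ` against `τ^(-1-β)` turns the Gaussian into a multiple of `u^(-1-α)`, which produces `I_1 +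
I_2` (`IsModulus.jumpAverage_gap`).

Substitute for the pointwise formula. Run a `β`-stable subordinator until it passes a level `h`.
Dynkin's formula for its occupation density `t^(β-1)` and its overshoot law is an identity of
Laplace transforms (`rpow_mul_integral_exp`). With `-Δ` in place of the Laplace variable it becomes
an identity of kernels (`integral_fracHeat`). Tested against `θ(x + ·) - θ(y + ·)`, it expresses a
short-time average of the heat extension of `g` through an overshoot average of `N`. The left side
is controlled by continuity of `g` at `x` and `y`, and the overshoot density dominates `τ^(-1-β)`;
letting `h → 0` gives the inequality (`jumpAverage_le_of_occupation`). Everything is nonnegative, so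
absolute convergence comes out of the same bound.

Signs and strictness are concavity: the gap is nonpositive and continuous, so a vanishing integral
makes it vanish identically, and this forces `ω` to be linear. -/

/-! ### Heat kernels of the plane and of the line. -/

abbrev Plane := EuclideanSpace ℝ (Fin 2)

/-- The heat kernel of the plane at time `t`. -/
noncomputable def heat (t : ℝ) (z : Plane) : ℝ :=
  (4 * Real.pi * t)⁻¹ * Real.exp (-‖z‖ ^ 2 / (4 * t))

/-- The heat kernel of the line at time `t`. -/
noncomputable def heatLine (t u : ℝ) : ℝ :=
  (√(4 * Real.pi * t))⁻¹ * Real.exp (-u ^ 2 / (4 * t))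

lemma heat_nonneg {t : ℝ} (ht : 0 ≤ t) (z : Plane) : 0 ≤ heat t z := by
  unfold heat; positivity

lemma heatLine_nonneg (t u : ℝ) : 0 ≤ heatLine t u := by
  unfold heatLine; positivity

lemma heatLine_neg (t u : ℝ) : heatLine t (-u) = heatLine t u := by
  simp [heatLine]

lemma measurable_heat : Measurable (fun p : ℝ × Plane => heat p.1 p.2) := by
  unfold heat; fun_prop

lemma measurable_heatLine : Measurable (fun p : ℝ × ℝ => heatLine p.1 p.2) := by
  unfold heatLine; fun_prop

lemma continuous_heat (t : ℝ) : Continuous (heat t) := by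
  unfold heat; fun_prop

lemma continuous_heatLine (t : ℝ) : Continuous (heatLine t) := by
  unfold heatLine; fun_prop

/-! ### Gaussians as Schwartz test functions. -/

lemma iteratedDeriv_cexp_neg_mul (b : ℝ) (n : ℕ) :
    iteratedDeriv n (fun u : ℝ => Complex.exp (-(b * u : ℝ))) =
      fun u : ℝ => (-(b : ℂ)) ^ n * Complex.exp (-(b * u : ℝ)) := by
  induction n with
  | zero => simp
  | succ n ih =>
    rw [iteratedDeriv_succ, ih]
    funext u
    have h1 : HasDerivAt (fun u : ℝ => (-(b * u : ℝ) : ℂ)) (-(b : ℂ)) u := by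
      have := ((hasDerivAt_id u).const_mul b).ofReal_comp.neg
      simp only [mul_one] at this
      exact this
    have := (h1.cexp.const_mul ((-(b : ℂ)) ^ n)).deriv
    rw [this]
    ring

lemma one_add_pow_mul_exp_neg_sq_bounded {b : ℝ} (hb : 0 < b) (m : ℕ) :
    ∃ C, ∀ s : ℝ, 0 ≤ s → (1 + s) ^ m * Real.exp (-(b * s ^ 2)) ≤ C := by
  refine ⟨m.factorial * Real.exp (1 + 1 / (4 * b)), fun s hs => ?_⟩
  have h1 : (1 + s) ^ m ≤ m.factorial * Real.exp (1 + s) := by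
    have := Real.pow_div_factorial_le_exp (1 + s) (by positivity) m
    rw [div_le_iff₀ (by positivity)] at this
    linarith
  -- Completing the square: the Gaussian absorbs the exponential that dominates the polynomial.
  have h2 : s ≤ b * s ^ 2 + 1 / (4 * b) := by
    have : b * s ^ 2 + 1 / (4 * b) - s = (2 * b * s - 1) ^ 2 / (4 * b) := by field_simp; ring
    have : 0 ≤ (2 * b * s - 1) ^ 2 / (4 * b) := by positivity
    linarith
  calc (1 + s) ^ m * Real.exp (-(b * s ^ 2))
      ≤ m.factorial * Real.exp (1 + s) * Real.exp (-(b * s ^ 2)) := by gcongr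
    _ = m.factorial * Real.exp (1 + s + -(b * s ^ 2)) := by
        rw [Real.exp_add (1 + s)]; ring
    _ ≤ _ := mul_le_mul_of_nonneg_left (Real.exp_le_exp.mpr (by linarith)) (by positivity)

/-- A centred Gaussian as a Schwartz function. -/
noncomputable def gaussSchwartz (b : ℝ) (hb : 0 < b) : 𝓢(Plane, ℂ) where
  toFun z := Complex.exp (-(b * ‖z‖ ^ 2 : ℝ))
  smooth' := by
    have : ContDiff ℝ ⊤ (fun z : Plane => ‖z‖ ^ 2) := contDiff_norm_sq ℝ
    have h : ContDiff ℝ ⊤ (fun z : Plane => -((b * ‖z‖ ^ 2 : ℝ) : ℂ)) :=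
      (Complex.ofRealCLM.contDiff.comp (contDiff_const.mul this)).neg
    exact (Complex.contDiff_exp.comp h).of_le le_top
  decay' := by
    intro k n
    have hf : ContDiff ℝ ⊤ (fun z : Plane => ‖z‖ ^ 2) := contDiff_norm_sq ℝ
    have hg : ContDiff ℝ ⊤ (fun u : ℝ => Complex.exp (-(b * u : ℝ))) :=
      Complex.contDiff_exp.comp
        (Complex.ofRealCLM.contDiff.comp (contDiff_const.mul contDiff_id)).neg
    obtain ⟨j, A, hA, hj⟩ := (Function.hasTemperateGrowth_norm_sq (H := Plane)).norm_iteratedFDeriv_le_uniform n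
    obtain ⟨C, hC⟩ := one_add_pow_mul_exp_neg_sq_bounded hb (k + j * n)
    refine ⟨n.factorial * (1 + b) ^ n * (1 + A) ^ n * C, fun z => ?_⟩
    -- Faà di Bruno bound for `u ↦ exp (-b u)` after `‖z‖ ^ 2`: each derivative is a polynomial
    -- weight times the same Gaussian.
    have key := norm_iteratedFDeriv_comp_le (n := n) hg hf le_top z
      (C := (1 + b) ^ n * Real.exp (-(b * ‖z‖ ^ 2))) (D := (1 + A) * (1 + ‖z‖) ^ j) ?_ ?_
    · have h1 : ‖z‖ ^ k ≤ (1 + ‖z‖) ^ k := by gcongr; linarith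
      calc _ ≤ (1 + ‖z‖) ^ k * (n.factorial * ((1 + b) ^ n * Real.exp (-(b * ‖z‖ ^ 2))) *
            ((1 + A) * (1 + ‖z‖) ^ j) ^ n) := by
            refine mul_le_mul h1 key (norm_nonneg _) (by positivity)
        _ = n.factorial * (1 + b) ^ n * (1 + A) ^ n *
            ((1 + ‖z‖) ^ (k + j * n) * Real.exp (-(b * ‖z‖ ^ 2))) := by
            rw [mul_pow, pow_add, pow_mul]; ring
        _ ≤ _ := by
            gcongr
            exact hC _ (norm_nonneg _)
    · intro i hi
      rw [norm_iteratedFDeriv_eq_norm_iteratedDeriv, iteratedDeriv_cexp_neg_mul]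
      simp only [norm_mul, norm_pow, norm_neg, Complex.norm_real, Complex.norm_exp,
        Complex.neg_re, Complex.ofReal_re]
      gcongr
      rw [Real.norm_of_nonneg hb.le]
      calc b ^ i ≤ (1 + b) ^ i := by gcongr; linarith
        _ ≤ (1 + b) ^ n := pow_le_pow_right₀ (by linarith) hi
    · intro i hi hin
      -- The composition bound asks for `D ^ i`. Taking `1 + A` instead of `A` makes `D ≥ 1`, so a
      -- bound by `D` is enough for every `i ≥ 1`.
      have h0 : 1 ≤ (1 + A) * (1 + ‖z‖) ^ j :=
        one_le_mul_of_one_le_of_one_le (by linarith) (one_le_pow₀ (by linarith [norm_nonneg z]))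
      calc _ ≤ A * (1 + ‖z‖) ^ j := hj i hin z
        _ ≤ (1 + A) * (1 + ‖z‖) ^ j := by gcongr; linarith
        _ ≤ _ := le_self_pow₀ h0 (by omega)

/-- The heat kernel centred at `x`, as a Schwartz function. -/
noncomputable def heatSchwartz (t : ℝ) (ht : 0 < t) (x : Plane) : 𝓢(Plane, ℂ) :=
  SchwartzMap.compSubConstCLM ℂ x
    (((4 * Real.pi * t : ℝ) : ℂ)⁻¹ • gaussSchwartz (1 / (4 * t)) (by positivity))

lemma heatSchwartz_apply {t : ℝ} (ht : 0 < t) (x z : Plane) :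
    heatSchwartz t ht x z = (heat t (z - x) : ℂ) := by
  rw [heatSchwartz, SchwartzMap.compSubConstCLM_apply, smul_apply]
  simp only [gaussSchwartz, heat, smul_eq_mul]
  change _ * Complex.exp _ = _
  push_cast
  congr 2
  ring

/-! ### Fourier representation, integrability and mass of the heat kernels. -/

/-- The Fourier transform of the Gaussian multiplier is the heat kernel. -/
lemma integral_fourier_heat {t : ℝ} (ht : 0 < t) (z : Plane) :
    ∫ ζ : Plane, Complex.exp (2 * Real.pi * inner ℝ ζ z * Complex.I) *
      (Real.exp (-t * (2 * Real.pi * ‖ζ‖) ^ 2) : ℂ) = (heat t z : ℂ) := by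
  have h := GaussianFourier.integral_cexp_neg_mul_sq_norm_add (V := Plane)
    (b := ((4 * Real.pi ^ 2 * t : ℝ) : ℂ)) (by rw [Complex.ofReal_re]; positivity) (2 * Real.pi * Complex.I) z
  rw [heat]
  convert h using 1
  · congr 1 with ζ
    rw [Complex.ofReal_exp, ← Complex.exp_add]
    congr 1
    push_cast
    rw [real_inner_comm]
    ring
  · have hpi : (Real.pi : ℂ) ≠ 0 := by exact_mod_cast Real.pi_ne_zero
    have ht' : (t : ℂ) ≠ 0 := by exact_mod_cast ht.ne'
    simp only [finrank_euclideanSpace, Fintype.card_fin]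
    push_cast
    rw [show (2 : ℂ) / 2 = 1 by norm_num, Complex.cpow_one]
    congr 1
    · field_simp
    · congr 1
      rw [mul_pow, mul_pow, Complex.I_sq]
      field_simp
      ring

lemma integrable_gauss_multiplier {t : ℝ} (ht : 0 < t) :
    Integrable (fun ζ : Plane => Real.exp (-t * (2 * Real.pi * ‖ζ‖) ^ 2)) := by
  have := GaussianFourier.integrable_cexp_neg_mul_sq_norm_add (V := Plane)
    (b := ((4 * Real.pi ^ 2 * t : ℝ) : ℂ)) (by rw [Complex.ofReal_re]; positivity) 0 0
  refine this.norm.congr (Filter.Eventually.of_forall fun ζ => ?_)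
  simp only [Complex.norm_exp]
  congr 1
  simp only [zero_mul, add_zero, ← Complex.ofReal_pow, ← Complex.ofReal_mul, ← Complex.ofReal_neg,
    Complex.ofReal_re]
  ring

lemma integrable_heat {t : ℝ} (ht : 0 < t) : Integrable (heat t) := by
  have := (integrable_gauss_multiplier (t := 1 / (16 * Real.pi ^ 2 * t))
    (by positivity)).const_mul ((4 * Real.pi * t)⁻¹)
  refine this.congr (Filter.Eventually.of_forall fun ζ => ?_)
  simp only [heat]
  congr 2
  field_simp
  ring

lemma integral_heat {t : ℝ} (ht : 0 < t) : ∫ z, heat t z = 1 := by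
  have h := GaussianFourier.integral_rexp_neg_mul_sq_norm (V := Plane)
    (b := 1 / (4 * t)) (by positivity)
  have h2 : ∀ z, heat t z = (4 * Real.pi * t)⁻¹ * Real.exp (-(1 / (4 * t)) * ‖z‖ ^ 2) := by
    intro z; rw [heat]; congr 2; ring
  simp only [h2, integral_const_mul, h, finrank_euclideanSpace, Fintype.card_fin]
  norm_num
  field_simp

lemma integrable_heatLine {t : ℝ} (ht : 0 < t) : Integrable (heatLine t) := by
  have := (integrable_exp_neg_mul_sq (b := 1 / (4 * t)) (by positivity)).const_mul
    ((√(4 * Real.pi * t))⁻¹)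
  refine this.congr (Filter.Eventually.of_forall fun u => ?_)
  simp only [heatLine]
  congr 2
  ring

lemma integral_heatLine {t : ℝ} (ht : 0 < t) : ∫ u, heatLine t u = 1 := by
  have h := integral_gaussian (1 / (4 * t))
  have h2 : ∀ u, heatLine t u = (√(4 * Real.pi * t))⁻¹ * Real.exp (-(1 / (4 * t)) * u ^ 2) := by
    intro z; rw [heatLine]; congr 2; ring
  simp only [h2, integral_const_mul, h]
  rw [show Real.pi / (1 / (4 * t)) = 4 * Real.pi * t by field_simp]
  exact inv_mul_cancel₀ (by positivity)

/-! ### Concave moduli and the sign of the gap. -/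

lemma IsModulus.nonneg {ω : ℝ → ℝ} (h : IsModulus ω) {s : ℝ} (hs : 0 ≤ s) : 0 ≤ ω s := by
  have := h.monotoneOn (Set.mem_Ici.2 le_rfl) (Set.mem_Ici.2 hs) hs
  rwa [h.map_zero] at this

lemma IsModulus.concave {ω : ℝ → ℝ} (h : IsModulus ω) {r s a b : ℝ} (hr : 0 ≤ r) (hs : 0 ≤ s)
    (ha : 0 ≤ a) (hb : 0 ≤ b) (hab : a + b = 1) : a * ω r + b * ω s ≤ ω (a * r + b * s) := by
  have := h.concaveOn.2 (Set.mem_Ici.2 hr) (Set.mem_Ici.2 hs) ha hb hab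
  simpa only [smul_eq_mul] using this

lemma IsModulus.mul_le {ω : ℝ → ℝ} (h : IsModulus ω) {r s : ℝ} (hr : 0 ≤ r) (hrs : r ≤ s)
    (hs : 0 < s) : r / s * ω s ≤ ω r := by
  have := h.concave hs.le le_rfl
    (a := r / s) (b := 1 - r / s) (by positivity) (by rw [sub_nonneg, div_le_one hs]; exact hrs)
    (by ring)
  simp only [h.map_zero, mul_zero, add_zero] at this
  rwa [div_mul_cancel₀ _ hs.ne'] at this

lemma IsModulus.subadd {ω : ℝ → ℝ} (h : IsModulus ω) {r s : ℝ} (hr : 0 ≤ r) (hs : 0 ≤ s) :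
    ω (r + s) ≤ ω r + ω s := by
  rcases (add_nonneg hr hs).eq_or_lt' with h0 | h0
  · have hr0 : r = 0 := by linarith
    have hs0 : s = 0 := by linarith
    simp [hr0, hs0, h.map_zero]
  · have h1 := h.mul_le hr (by linarith) h0
    have h2 := h.mul_le hs (by linarith) h0
    have : r / (r + s) * ω (r + s) + s / (r + s) * ω (r + s) = ω (r + s) := by
      field_simp
    linarith

lemma IsModulus.midpoint {ω : ℝ → ℝ} (h : IsModulus ω) {r s : ℝ} (hr : 0 ≤ r) (hs : 0 ≤ s) :
    ω r + ω s ≤ 2 * ω ((r + s) / 2) := by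
  have := h.concave hr hs
    (a := 1 / 2) (b := 1 / 2) (by norm_num) (by norm_num) (by norm_num)
  rw [show (r + s) / 2 = 1 / 2 * r + 1 / 2 * s by ring]
  linarith

lemma IsModulus.le_linear {ω : ℝ → ℝ} (h : IsModulus ω) {s : ℝ} (hs : 0 ≤ s) :
    ω s ≤ ω 1 * (1 + s) := by
  have h1 := h.nonneg zero_le_one
  rcases le_or_gt s 1 with h2 | h2
  · have := h.monotoneOn (Set.mem_Ici.2 hs) (Set.mem_Ici.2 zero_le_one) h2
    nlinarith
  · have := h.mul_le zero_le_one h2.le (by linarith)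
    rw [div_mul_eq_mul_div, one_mul, div_le_iff₀ (by linarith)] at this
    nlinarith

/-- The common numerator of `nearIntegrand` and `farIntegrand`. -/
noncomputable def modulusGap (ω : ℝ → ℝ) (ξ u : ℝ) : ℝ :=
  if u < ξ / 2 then ω (ξ + 2 * u) + ω (ξ - 2 * u) - 2 * ω ξ
  else ω (2 * u + ξ) - ω (2 * u - ξ) - 2 * ω ξ

/-- Midpoint concavity about `ξ` on the near branch. On the far branch, subadditivity twice: passing
from `2u - ξ` to `2u` and on to `2u + ξ` costs at most `ω ξ` each time. -/
lemma IsModulus.modulusGap_nonpos {ω : ℝ → ℝ} (h : IsModulus ω) {ξ u : ℝ} (hξ : 0 < ξ)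
    (hu : 0 ≤ u) : modulusGap ω ξ u ≤ 0 := by
  unfold modulusGap
  split_ifs with hc
  · have := h.midpoint (r := ξ + 2 * u) (s := ξ - 2 * u) (by linarith) (by linarith)
    rw [show (ξ + 2 * u + (ξ - 2 * u)) / 2 = ξ by ring] at this
    linarith
  · push Not at hc
    have h1 := h.subadd (r := 2 * u - ξ) (s := ξ) (by linarith) hξ.le
    have h2 := h.subadd (r := 2 * u) (s := ξ) (by linarith) hξ.le
    rw [show 2 * u - ξ + ξ = 2 * u by ring] at h1
    linarith

lemma IsModulus.continuous_posPart {ω : ℝ → ℝ} (h : IsModulus ω) {f : ℝ → ℝ} (hf : Continuous f) :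
    Continuous (fun u => ω (max (f u) 0)) :=
  h.continuousOn.comp_continuous (by fun_prop) (fun u => Set.mem_Ici.2 (le_max_right _ _))

/-- Since `ω 0 = 0`, the two branches merge into one formula in positive parts, in which the
irrelevant term vanishes; in particular they agree at `ξ / 2`. -/
lemma IsModulus.continuousOn_modulusGap {ω : ℝ → ℝ} (h : IsModulus ω) {ξ : ℝ} (hξ : 0 < ξ) :
    ContinuousOn (modulusGap ω ξ) (Set.Ici 0) := by
  have key : Continuous (fun u => ω (max (ξ + 2 * u) 0) + ω (max (ξ - 2 * u) 0)
      - ω (max (2 * u - ξ) 0) - 2 * ω ξ) := by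
    have h1 := h.continuous_posPart (f := fun u => ξ + 2 * u) (by fun_prop)
    have h2 := h.continuous_posPart (f := fun u => ξ - 2 * u) (by fun_prop)
    have h3 := h.continuous_posPart (f := fun u => 2 * u - ξ) (by fun_prop)
    exact ((h1.add h2).sub h3).sub continuous_const
  refine key.continuousOn.congr fun u hu => ?_
  have hu : 0 ≤ u := hu
  unfold modulusGap
  beta_reduce
  split_ifs with hu2
  · rw [max_eq_left (by linarith), max_eq_left (by linarith), max_eq_right (by linarith),
      h.map_zero]
    ring
  · rw [max_eq_left (by linarith), max_eq_right (by linarith), max_eq_left (by linarith),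
      h.map_zero, add_comm ξ]
    ring

/-- Nothing is known of `ω` at negative arguments, so the gap is cut off there to be globally
measurable for Tonelli. -/
lemma IsModulus.measurable_modulusGap_indicator {ω : ℝ → ℝ} (h : IsModulus ω) {ξ : ℝ}
    (hξ : 0 < ξ) : Measurable ((Set.Ioi 0).indicator (modulusGap ω ξ)) := by
  have h1 := ((h.continuousOn_modulusGap hξ).mono Set.Ioi_subset_Ici_self)
  have := measurable_of_continuousOn_compl_singleton (f := (Set.Ioi 0).indicator (modulusGap ω ξ)) 0 ?_
  · exact this
  · intro u hu
    apply ContinuousAt.continuousWithinAt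
    rcases lt_or_gt_of_ne (show u ≠ 0 from hu) with h0 | h0
    · refine (continuousAt_const (y := (0 : ℝ))).congr ?_
      filter_upwards [Iio_mem_nhds h0] with v hv
      rw [Set.indicator_of_notMem]
      simp only [Set.mem_Ioi, not_lt]; exact le_of_lt hv
    · refine (h1.continuousAt (Ioi_mem_nhds h0)).congr ?_
      filter_upwards [Ioi_mem_nhds h0] with v hv
      rw [Set.indicator_of_mem hv]

lemma nearIntegrand_eq (α : ℝ) (ω : ℝ → ℝ) (ξ : ℝ) {u : ℝ} (hu : u ∈ Set.Ioo 0 (ξ / 2)) :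
    nearIntegrand α ω ξ u = modulusGap ω ξ u / u ^ (1 + α) := by
  rw [nearIntegrand, modulusGap, if_pos hu.2]

lemma farIntegrand_eq (α : ℝ) (ω : ℝ → ℝ) (ξ : ℝ) {u : ℝ} (hu : u ∈ Set.Ioi (ξ / 2)) :
    farIntegrand α ω ξ u = modulusGap ω ξ u / u ^ (1 + α) := by
  rw [farIntegrand, modulusGap, if_neg (not_lt.2 (le_of_lt hu))]

lemma IsModulus.continuousOn_gap_div {ω : ℝ → ℝ} (h : IsModulus ω) {ξ : ℝ} (hξ : 0 < ξ) (α : ℝ) :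
    ContinuousOn (fun u => modulusGap ω ξ u / u ^ (1 + α)) (Set.Ioi 0) := by
  refine ((h.continuousOn_modulusGap hξ).mono Set.Ioi_subset_Ici_self).div ?_ ?_
  · exact fun u hu => (Real.continuousAt_rpow_const _ _ (Or.inl (ne_of_gt hu))).continuousWithinAt
  · exact fun u hu => (Real.rpow_pos_of_pos hu _).ne'

/-! ### The case of equality: strict negativity of the two integrals. -/

/-- A continuous nonpositive function on an open set whose integral is not negative vanishes. -/
lemma eq_zero_of_integral_nonneg {f : ℝ → ℝ} {s : Set ℝ} (hs : IsOpen s) (hf : ContinuousOn f s)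
    (hle : ∀ u ∈ s, f u ≤ 0) (hi : IntegrableOn f s) (h0 : 0 ≤ ∫ u in s, f u) :
    ∀ u ∈ s, f u = 0 := by
  have h1 : ∫ u in s, -f u = 0 := by
    rw [integral_neg, neg_eq_zero]
    exact le_antisymm (setIntegral_nonpos hs.measurableSet hle) h0
  change ∫ u in s, (-f) u = 0 at h1
  rw [setIntegral_eq_zero_iff_of_nonneg_ae
    ((ae_restrict_iff' hs.measurableSet).2 (Filter.Eventually.of_forall fun u hu => by
      simpa using hle u hu)) hi.neg] at h1
  have h2 : f =ᵐ[volume.restrict s] (fun _ => (0 : ℝ)) := by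
    filter_upwards [h1] with u hu
    simpa using hu
  intro u hu
  exact Measure.eqOn_open_of_ae_eq h2 hs hf continuousOn_const hu

/-- A concave graph through three collinear points, here over `0`, `ξ` and `R`, is straight between
the outer two. -/
lemma IsModulus.eq_linear_of_three {ω : ℝ → ℝ} (h : IsModulus ω) {ξ R : ℝ} (hξ : 0 < ξ)
    (hR : ξ < R) (hval : ω R = ω ξ / ξ * R) {s : ℝ} (hs : s ∈ Set.Icc 0 R) :
    ω s = ω ξ / ξ * s := by
  have hR0 : 0 < R := hξ.trans hR
  have hge : ω ξ / ξ * s ≤ ω s := by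
    have := h.mul_le hs.1 hs.2 hR0
    rw [hval] at this
    calc _ = s / R * (ω ξ / ξ * R) := by field_simp
      _ ≤ _ := this
  refine le_antisymm ?_ hge
  rcases le_or_gt s ξ with hsξ | hsξ
  · rcases hsξ.eq_or_lt with rfl | hsξ
    · rw [div_mul_cancel₀ _ hξ.ne']
    -- `ξ` lies strictly between `s` and `R`
    have hd : 0 < R - s := by linarith
    have := h.concave hs.1 hR0.le
      (a := (R - ξ) / (R - s)) (b := (ξ - s) / (R - s))
      (div_nonneg (by linarith) hd.le) (div_nonneg (by linarith) hd.le)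
      (by rw [← add_div, div_eq_one_iff_eq hd.ne']; ring)
    rw [show (R - ξ) / (R - s) * s + (ξ - s) / (R - s) * R = ξ by field_simp; ring, hval,
      div_mul_eq_mul_div, div_mul_eq_mul_div, ← add_div, div_le_iff₀ hd] at this
    have h3 : ω ξ / ξ * ξ = ω ξ := div_mul_cancel₀ _ hξ.ne'
    have h4 : (R - ξ) * (ω s - ω ξ / ξ * s) ≤ 0 := by
      generalize ω ξ / ξ = k at *
      rw [← h3] at this
      nlinarith
    have : ω s - ω ξ / ξ * s ≤ 0 := nonpos_of_mul_nonpos_right h4 (by linarith)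
    linarith
  · have := h.mul_le hξ.le hsξ.le (hξ.trans hsξ)
    rw [div_mul_eq_mul_div, div_le_iff₀ (hξ.trans hsξ)] at this
    rw [div_mul_eq_mul_div, le_div_iff₀ hξ]
    linarith

/-- If the integral vanished, the gap would vanish on the closed interval by continuity. Its value
at the endpoint `ξ / 2` is `ω (2ξ) - 2 ω ξ`, which makes the points over `0`, `ξ`, `2ξ` collinear.
-/
lemma IsModulus.near_neg {ω : ℝ → ℝ} (h : IsModulus ω) {α ξ : ℝ} (hξ : 0 < ξ)
    (hi : IntegrableOn (nearIntegrand α ω ξ) (Set.Ioo 0 (ξ / 2)) volume)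
    (hne : ∃ s ∈ Set.Icc 0 (2 * ξ), ω s ≠ ω ξ / ξ * s) :
    (∫ η in Set.Ioo 0 (ξ / 2), nearIntegrand α ω ξ η) < 0 := by
  by_contra hcon
  push Not at hcon
  have hpos : ∀ u ∈ Set.Ioo 0 (ξ / 2), 0 < u ^ (1 + α) := fun u hu => Real.rpow_pos_of_pos hu.1 _
  have hz := eq_zero_of_integral_nonneg isOpen_Ioo
    (((h.continuousOn_gap_div hξ α).mono Set.Ioo_subset_Ioi_self).congr fun u hu => nearIntegrand_eq α ω ξ hu)
    (fun u hu => by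
      rw [nearIntegrand_eq α ω ξ hu]
      exact div_nonpos_of_nonpos_of_nonneg (h.modulusGap_nonpos hξ hu.1.le) (hpos u hu).le) hi hcon
  have hgap : Set.EqOn (modulusGap ω ξ) (fun _ => 0) (Set.Ioo 0 (ξ / 2)) := fun u hu => by
    have := hz u hu
    rw [nearIntegrand_eq α ω ξ hu, div_eq_zero_iff] at this
    exact this.resolve_right (hpos u hu).ne'
  have hend : modulusGap ω ξ (ξ / 2) = 0 := by
    have := hgap.of_subset_closure (t := Set.Icc 0 (ξ / 2))
      ((h.continuousOn_modulusGap hξ).mono Set.Icc_subset_Ici_self) continuousOn_const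
      Set.Ioo_subset_Icc_self (by rw [closure_Ioo (by positivity)])
    exact this (Set.right_mem_Icc.2 (by positivity))
  rw [modulusGap, if_neg (lt_irrefl _), show 2 * (ξ / 2) + ξ = 2 * ξ by ring,
    show 2 * (ξ / 2) - ξ = 0 by ring, h.map_zero] at hend
  obtain ⟨s, hs, hne⟩ := hne
  refine hne (h.eq_linear_of_three hξ (by linarith) ?_ hs)
  field_simp
  linarith

/-- A vanishing gap makes `ω` grow by exactly `2 ω ξ` over each step `2ξ`. The points over `0`, `ξ`
and `2nξ` are then collinear for arbitrarily large `n`. -/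
lemma IsModulus.far_neg {ω : ℝ → ℝ} (h : IsModulus ω) {α ξ : ℝ} (hξ : 0 < ξ)
    (hi : IntegrableOn (farIntegrand α ω ξ) (Set.Ioi (ξ / 2)) volume)
    (hne : ∃ s ∈ Set.Ici (0 : ℝ), ω s ≠ ω ξ / ξ * s) :
    (∫ η in Set.Ioi (ξ / 2), farIntegrand α ω ξ η) < 0 := by
  by_contra hcon
  push Not at hcon
  have hsub : Set.Ioi (ξ / 2) ⊆ Set.Ioi 0 := Set.Ioi_subset_Ioi (by positivity)
  have hpos : ∀ u ∈ Set.Ioi (ξ / 2), 0 < u ^ (1 + α) :=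
    fun u hu => Real.rpow_pos_of_pos (hsub hu) _
  have hz := eq_zero_of_integral_nonneg isOpen_Ioi
    (((h.continuousOn_gap_div hξ α).mono hsub).congr fun u hu => farIntegrand_eq α ω ξ hu)
    (fun u hu => by
      rw [farIntegrand_eq α ω ξ hu]
      exact div_nonpos_of_nonpos_of_nonneg (h.modulusGap_nonpos hξ (le_of_lt (hsub hu)))
        (hpos u hu).le) hi hcon
  have hgap : Set.EqOn (modulusGap ω ξ) (fun _ => 0) (Set.Ioi (ξ / 2)) := fun u hu => by
    have := hz u hu
    rw [farIntegrand_eq α ω ξ hu, div_eq_zero_iff] at this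
    exact this.resolve_right (hpos u hu).ne'
  have hgap' : ∀ u ∈ Set.Ici (ξ / 2), modulusGap ω ξ u = 0 :=
    hgap.of_subset_closure ((h.continuousOn_modulusGap hξ).mono (fun u hu =>
      le_trans (by positivity) (Set.mem_Ici.1 hu))) continuousOn_const
      Set.Ioi_subset_Ici_self (by rw [closure_Ioi])
  have hstep : ∀ v : ℝ, 0 ≤ v → ω (v + 2 * ξ) = ω v + 2 * ω ξ := fun v hv => by
    have := hgap' ((v + ξ) / 2) (Set.mem_Ici.2 (by linarith))
    rw [modulusGap, if_neg (by linarith), show 2 * ((v + ξ) / 2) + ξ = v + 2 * ξ by ring,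
      show 2 * ((v + ξ) / 2) - ξ = v by ring] at this
    linarith
  have hmul : ∀ n : ℕ, ω (n * (2 * ξ)) = n * (2 * ω ξ) := fun n => by
    induction n with
    | zero => simp [h.map_zero]
    | succ n ih =>
      push_cast
      rw [add_mul, one_mul, hstep _ (by positivity), ih]
      ring
  obtain ⟨s, hs, hne⟩ := hne
  obtain ⟨n, hn⟩ := exists_nat_gt (max 1 (s / (2 * ξ)))
  have hn1 : (1 : ℝ) < n := (le_max_left _ _).trans_lt hn
  have hn2 : s < n * (2 * ξ) := by
    rw [← div_lt_iff₀ (by positivity)]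
    exact (le_max_right _ _).trans_lt hn
  refine hne (h.eq_linear_of_three hξ (R := n * (2 * ξ)) (by nlinarith) ?_ ⟨hs, hn2.le⟩)
  rw [hmul]
  field_simp

/-! ### The extremal problem on the line. -/

/-- The odd function on the line with `oddProfile ω v - oddProfile ω (-v) = ω (2 v)` for `v ≥ 0`. -/
noncomputable def oddProfile (ω : ℝ → ℝ) (v : ℝ) : ℝ := (ω (max (2 * v) 0) - ω (max (-2 * v) 0)) / 2

lemma oddProfile_neg (ω : ℝ → ℝ) (v : ℝ) : oddProfile ω (-v) = -oddProfile ω v := by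
  unfold oddProfile
  rw [show 2 * -v = -2 * v by ring, show -2 * -v = 2 * v by ring]
  ring

lemma IsModulus.continuous_oddProfile {ω : ℝ → ℝ} (h : IsModulus ω) : Continuous (oddProfile ω) := by
  have h1 := h.continuous_posPart (f := fun v => 2 * v) (by fun_prop)
  have h2 := h.continuous_posPart (f := fun v => -2 * v) (by fun_prop)
  exact (h1.sub h2).div_const 2

lemma IsModulus.oddProfile_of_nonneg {ω : ℝ → ℝ} (h : IsModulus ω) {v : ℝ} (hv : 0 ≤ v) :
    oddProfile ω v = ω (2 * v) / 2 := by
  rw [oddProfile, max_eq_left (by linarith), max_eq_right (by linarith), h.map_zero, sub_zero]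

lemma IsModulus.abs_oddProfile_le {ω : ℝ → ℝ} (h : IsModulus ω) (v : ℝ) :
    |oddProfile ω v| ≤ 2 * ω 1 * (1 + |v|) := by
  have key : ∀ v : ℝ, 0 ≤ v → |oddProfile ω v| ≤ 2 * ω 1 * (1 + |v|) := fun v hv => by
    have h1 := h.le_linear (s := 2 * v) (by linarith)
    have h2 := h.nonneg (s := 2 * v) (by linarith)
    have h3 := h.nonneg zero_le_one
    rw [h.oddProfile_of_nonneg hv, abs_of_nonneg (by linarith), abs_of_nonneg hv]
    nlinarith
  rcases le_total 0 v with hv | hv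
  · exact key v hv
  · have := key (-v) (by linarith)
    rwa [oddProfile_neg, abs_neg, abs_neg] at this

/-- The near and far numerators are one expression: they differ only in the sign of `u - ξ / 2`, at
which the odd profile is evaluated. -/
lemma IsModulus.oddProfile_diff {ω : ℝ → ℝ} (h : IsModulus ω) {ξ u : ℝ} (hξ : 0 < ξ) (hu : 0 < u) :
    2 * (oddProfile ω (u + ξ / 2) - oddProfile ω (u - ξ / 2)) = modulusGap ω ξ u + 2 * ω ξ := by
  rw [modulusGap]
  split_ifs with hc
  · rw [h.oddProfile_of_nonneg (by linarith), show u - ξ / 2 = -(ξ / 2 - u) by ring,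
      oddProfile_neg, h.oddProfile_of_nonneg (by linarith),
      show 2 * (u + ξ / 2) = ξ + 2 * u by ring, show 2 * (ξ / 2 - u) = ξ - 2 * u by ring]
    ring
  · rw [h.oddProfile_of_nonneg (by linarith), h.oddProfile_of_nonneg (by linarith),
      show 2 * (u + ξ / 2) = 2 * u + ξ by ring, show 2 * (u - ξ / 2) = 2 * u - ξ by ring]
    ring

lemma integrable_heatLine_mul_linear {t : ℝ} (ht : 0 < t) :
    Integrable (fun u => heatLine t u * (1 + |u|)) := by
  have h1 := integrable_heatLine ht
  have h2 := ((integrable_mul_exp_neg_mul_sq (b := 1 / (4 * t)) (by positivity)).const_mul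
    ((√(4 * Real.pi * t))⁻¹)).abs
  refine (h1.add h2).congr (Filter.Eventually.of_forall fun u => ?_)
  simp only [Pi.add_apply, heatLine, abs_mul, Real.abs_exp]
  rw [abs_of_nonneg (by positivity : 0 ≤ (√(4 * Real.pi * t))⁻¹),
    show -(1 / (4 * t)) * u ^ 2 = -u ^ 2 / (4 * t) by ring]
  ring

lemma integrable_heatLine_mul_shift {t : ℝ} (ht : 0 < t) {f : ℝ → ℝ} (hf : Continuous f) {C : ℝ}
    (hC : ∀ v, |f v| ≤ C * (1 + |v|)) (a : ℝ) :
    Integrable (fun u => heatLine t u * f (u + a)) := by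
  refine ((integrable_heatLine_mul_linear ht).const_mul (C * (1 + |a|))).mono'
    (((continuous_heatLine t).mul (by fun_prop)).aestronglyMeasurable)
    (Filter.Eventually.of_forall fun u => ?_)
  have hC0 : 0 ≤ C := by
    have := (abs_nonneg _).trans (hC 0)
    simpa using this
  have h1 : |f (u + a)| ≤ C * ((1 + |a|) * (1 + |u|)) := by
    refine (hC _).trans (mul_le_mul_of_nonneg_left ?_ hC0)
    nlinarith [abs_add_le u a, abs_nonneg u, abs_nonneg a, mul_nonneg (abs_nonneg u) (abs_nonneg a)]
  rw [Real.norm_eq_abs, abs_mul, abs_of_nonneg (heatLine_nonneg t u)]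
  calc _ ≤ heatLine t u * (C * ((1 + |a|) * (1 + |u|))) :=
        mul_le_mul_of_nonneg_left h1 (heatLine_nonneg t u)
    _ = _ := by ring

lemma integral_heatLine_shift {t : ℝ} (f : ℝ → ℝ) (a : ℝ) :
    ∫ u, heatLine t u * f (u + a) = ∫ u, heatLine t (u - a) * f u := by
  rw [← integral_sub_right_eq_self (fun u => heatLine t u * f (u + a)) a]
  simp

lemma heatLine_le_of_abs_le {t u v : ℝ} (ht : 0 < t) (h : |u| ≤ |v|) :
    heatLine t v ≤ heatLine t u := by
  unfold heatLine
  have : u ^ 2 ≤ v ^ 2 := sq_le_sq.2 h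
  gcongr

/-- Among functions with modulus of continuity `ω`, the odd profile has the largest
Gaussian-averaged increment. -/
lemma IsModulus.heatLine_increment_le {ω : ℝ → ℝ} (h : IsModulus ω) {f : ℝ → ℝ} (hf : Continuous f)
    (hω : ∀ a b, |f a - f b| ≤ ω |a - b|) {ξ t : ℝ} (hξ : 0 < ξ) (ht : 0 < t) :
    ∫ u, heatLine t u * (f (u + ξ / 2) - f (u - ξ / 2)) ≤
      ∫ u, heatLine t u * (oddProfile ω (u + ξ / 2) - oddProfile ω (u - ξ / 2)) := by
  have h3 := h.nonneg zero_le_one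
  have hfC : ∀ v, |f v| ≤ (|f 0| + ω 1) * (1 + |v|) := fun v => by
    have h1 := (hω v 0).trans (by simpa using h.le_linear (abs_nonneg v))
    have h2 : |f v| ≤ |f v - f 0| + |f 0| := by simpa using abs_add_le (f v - f 0) (f 0)
    nlinarith [abs_nonneg (f 0), abs_nonneg v, mul_nonneg (abs_nonneg (f 0)) (abs_nonneg v)]
  -- The profile minus the odd part of `f`: odd, and nonnegative on the right because `f v - f (-v)
  -- ≤ ω (2v)`.
  set e : ℝ → ℝ := fun v => oddProfile ω v - (f v - f (-v)) / 2 with he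
  have hpc := h.continuous_oddProfile
  have hpC := h.abs_oddProfile_le
  have hec : Continuous e := by fun_prop
  have heC : ∀ v, |e v| ≤ (2 * ω 1 + (|f 0| + ω 1)) * (1 + |v|) := fun v => by
    have h1 := hpC v
    have h2 := hfC v
    have h4 := hfC (-v)
    rw [abs_neg] at h4
    simp only [he]
    rw [abs_le] at *
    constructor <;> nlinarith
  have heodd : ∀ v, e (-v) = -e v := fun v => by
    simp only [he, oddProfile_neg, neg_neg]; ring
  have hepos : ∀ v, 0 ≤ v → 0 ≤ e v := fun v hv => by
    have h1 := (le_abs_self _).trans (hω v (-v))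
    rw [sub_neg_eq_add, ← two_mul, abs_of_nonneg (by linarith)] at h1
    simp only [he, h.oddProfile_of_nonneg hv]
    linarith
  -- For `v ≥ 0` the point `v` is nearer to `ξ / 2` than to `-ξ / 2`, so the kernel difference has
  -- the sign of `v`, as does `e`.
  have hker : ∀ v, 0 ≤ (heatLine t (v - ξ / 2) - heatLine t (v + ξ / 2)) * e v := fun v => by
    rcases le_total 0 v with hv | hv
    · refine mul_nonneg (sub_nonneg.2 (heatLine_le_of_abs_le ht ?_)) (hepos v hv)
      rw [abs_of_nonneg (by linarith : 0 ≤ v + ξ / 2), abs_le]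
      constructor <;> linarith
    · refine mul_nonneg_of_nonpos_of_nonpos
        (sub_nonpos.2 (heatLine_le_of_abs_le ht ?_)) ?_
      · rw [abs_of_nonpos (by linarith : v - ξ / 2 ≤ 0), abs_le]
        constructor <;> linarith
      · have := hepos (-v) (by linarith)
        rw [heodd] at this
        linarith
  have hie1 := integrable_heatLine_mul_shift ht hec heC (ξ / 2)
  have hie2 := integrable_heatLine_mul_shift ht hec heC (-(ξ / 2))
  have hif1 := integrable_heatLine_mul_shift ht hf hfC (ξ / 2)
  have hif2 := integrable_heatLine_mul_shift ht hf hfC (-(ξ / 2))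
  have hip1 := integrable_heatLine_mul_shift ht hpc hpC (ξ / 2)
  have hip2 := integrable_heatLine_mul_shift ht hpc hpC (-(ξ / 2))
  have hepos_int : 0 ≤ ∫ u, (heatLine t u * e (u + ξ / 2) - heatLine t u * e (u + -(ξ / 2))) := by
    rw [integral_sub hie1 hie2, integral_heatLine_shift, integral_heatLine_shift, ← integral_sub]
    · refine integral_nonneg fun v => ?_
      have := hker v
      simp only [sub_neg_eq_add]
      rw [sub_mul] at this
      exact this
    · have := hie1.comp_sub_right (ξ / 2)
      simpa using this
    · have := hie2.comp_sub_right (-(ξ / 2))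
      simpa using this
  -- Reflection `u ↦ -u`: replacing `f` by its odd part does not change the averaged increment.
  have hswap : ∫ u, heatLine t u * (f (-(u + ξ / 2)) - f (-(u - ξ / 2))) =
      - ∫ u, heatLine t u * (f (u + ξ / 2) - f (u - ξ / 2)) := by
    rw [← integral_neg, ← integral_neg_eq_self]
    refine integral_congr_ae (Filter.Eventually.of_forall fun u => ?_)
    simp only [heatLine_neg]
    rw [show -(-u + ξ / 2) = u - ξ / 2 by ring, show -(-u - ξ / 2) = u + ξ / 2 by ring]
    ring
  have hi1 : Integrable (fun u => heatLine t u * (f (u + ξ / 2) - f (u - ξ / 2))) := by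
    refine (hif1.sub hif2).congr (Filter.Eventually.of_forall fun u => ?_)
    simp only [Pi.sub_apply, ← sub_eq_add_neg, mul_sub]
  have hi2 : Integrable (fun u => heatLine t u * (f (-(u + ξ / 2)) - f (-(u - ξ / 2)))) := by
    have := hi1.comp_neg.neg
    refine this.congr (Filter.Eventually.of_forall fun u => ?_)
    simp only [heatLine_neg, Pi.neg_apply]
    rw [show -(u + ξ / 2) = -u - ξ / 2 by ring, show -(u - ξ / 2) = -u + ξ / 2 by ring]
    ring
  have hi3 : Integrable
      (fun u => heatLine t u * (oddProfile ω (u + ξ / 2) - oddProfile ω (u - ξ / 2))) := by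
    refine (hip1.sub hip2).congr (Filter.Eventually.of_forall fun u => ?_)
    simp only [Pi.sub_apply, ← sub_eq_add_neg, mul_sub]
  have hi4 : Integrable (fun u => (heatLine t u * (f (u + ξ / 2) - f (u - ξ / 2)) -
      heatLine t u * (f (-(u + ξ / 2)) - f (-(u - ξ / 2)))) / 2) := (hi1.sub hi2).div_const 2
  have hsplit : ∫ u, (heatLine t u * e (u + ξ / 2) - heatLine t u * e (u + -(ξ / 2))) =
      (∫ u, heatLine t u * (oddProfile ω (u + ξ / 2) - oddProfile ω (u - ξ / 2))) -
      ((∫ u, heatLine t u * (f (u + ξ / 2) - f (u - ξ / 2))) -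
        ∫ u, heatLine t u * (f (-(u + ξ / 2)) - f (-(u - ξ / 2)))) / 2 := by
    rw [← integral_sub hi1 hi2, ← integral_div, ← integral_sub hi3 hi4]
    refine integral_congr_ae (Filter.Eventually.of_forall fun u => ?_)
    simp only [he, ← sub_eq_add_neg]
    ring
  rw [hsplit, hswap] at hepos_int
  linarith

lemma IsModulus.integrableOn_heatLine_gap {ω : ℝ → ℝ} (h : IsModulus ω) {ξ t : ℝ} (hξ : 0 < ξ)
    (ht : 0 < t) : IntegrableOn (fun u => heatLine t u * modulusGap ω ξ u) (Set.Ioi 0) := by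
  have hpc := h.continuous_oddProfile
  have hpC := h.abs_oddProfile_le
  have hip1 := integrable_heatLine_mul_shift ht hpc hpC (ξ / 2)
  have hip2 := integrable_heatLine_mul_shift ht hpc hpC (-(ξ / 2))
  have := (((hip1.sub hip2).const_mul 2).sub
    ((integrable_heatLine ht).mul_const (2 * ω ξ))).integrableOn (s := Set.Ioi 0)
  refine this.congr_fun (fun u hu => ?_) measurableSet_Ioi
  have h1 := h.oddProfile_diff hξ hu
  simp only [Pi.sub_apply, ← sub_eq_add_neg]
  linear_combination heatLine t u * h1

/-- The increment of an odd function over `[u - ξ/2, u + ξ/2]` is even in `u`, so the integral folds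
onto the half-line, where the Gaussian has mass `1/2`. -/
lemma IsModulus.heatLine_oddProfile {ω : ℝ → ℝ} (h : IsModulus ω) {ξ t : ℝ} (hξ : 0 < ξ)
    (ht : 0 < t) :
    ∫ u, heatLine t u * (oddProfile ω (u + ξ / 2) - oddProfile ω (u - ξ / 2)) =
      ω ξ + ∫ u in Set.Ioi 0, heatLine t u * modulusGap ω ξ u := by
  have heven : ∀ u, heatLine t u * (oddProfile ω (u + ξ / 2) - oddProfile ω (u - ξ / 2)) =
      heatLine t |u| * (oddProfile ω (|u| + ξ / 2) - oddProfile ω (|u| - ξ / 2)) := fun u => by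
    rcases abs_choice u with hu | hu <;> rw [hu]
    rw [heatLine_neg, show -u + ξ / 2 = -(u - ξ / 2) by ring,
      show -u - ξ / 2 = -(u + ξ / 2) by ring, oddProfile_neg, oddProfile_neg]
    ring
  have hone : 2 * ∫ u in Set.Ioi 0, heatLine t u = 1 := by
    rw [← integral_comp_abs, ← integral_heatLine ht]
    congr 1 with u
    rcases abs_choice u with hu | hu <;> rw [hu]
    rw [heatLine_neg]
  have hi := h.integrableOn_heatLine_gap hξ ht
  rw [integral_congr_ae (Filter.Eventually.of_forall heven), integral_comp_abs (f := fun u => heatLine t u * (oddProfile ω (u + ξ / 2) -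
    oddProfile ω (u - ξ / 2))), ← integral_const_mul]
  have : ∀ u ∈ Set.Ioi (0 : ℝ), 2 * (heatLine t u * (oddProfile ω (u + ξ / 2) -
      oddProfile ω (u - ξ / 2))) = heatLine t u * (2 * ω ξ) + heatLine t u * modulusGap ω ξ u :=
    fun u hu => by
      linear_combination heatLine t u * h.oddProfile_diff hξ hu
  rw [setIntegral_congr_fun measurableSet_Ioi this,
    integral_add ((integrable_heatLine ht).integrableOn.mul_const _) hi, integral_mul_const]
  linear_combination ω ξ * hone

/-! ### Subordination integrals and their constants. -/

/-- A function on the half-line bounded by one power near zero and by another near infinity. -/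
lemma integrableOn_of_two_powers {f : ℝ → ℝ} {A B a b R : ℝ} (hR : 0 < R) (ha : -1 < a)
    (hb : b < -1) (hf : AEStronglyMeasurable f (volume.restrict (Set.Ioi 0)))
    (h1 : ∀ r, 0 < r → r ≤ R → |f r| ≤ A * r ^ a) (h2 : ∀ r, R < r → |f r| ≤ B * r ^ b) :
    IntegrableOn f (Set.Ioi 0) ∧
      |∫ r in Set.Ioi 0, f r| ≤ A * (R ^ (a + 1) / (a + 1)) + B * (-R ^ (b + 1) / (b + 1)) := by
  have hi1 : IntegrableOn (fun r : ℝ => A * r ^ a) (Set.Ioc 0 R) := by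
    have := (intervalIntegral.intervalIntegrable_rpow' (a := 0) (b := R) ha).const_mul A
    rwa [intervalIntegrable_iff_integrableOn_Ioc_of_le hR.le] at this
  have hi2 : IntegrableOn (fun r : ℝ => B * r ^ b) (Set.Ioi R) :=
    (integrableOn_Ioi_rpow_of_lt hb hR).const_mul B
  have hv1 : ∫ r in Set.Ioc 0 R, A * r ^ a = A * (R ^ (a + 1) / (a + 1)) := by
    rw [← intervalIntegral.integral_of_le hR.le, intervalIntegral.integral_const_mul,
      integral_rpow (Or.inl ha), Real.zero_rpow (by linarith), sub_zero]
  have hv2 : ∫ r in Set.Ioi R, B * r ^ b = B * (-R ^ (b + 1) / (b + 1)) := by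
    rw [integral_const_mul, integral_Ioi_rpow_of_lt hb hR]
  have hu := Set.Ioc_union_Ioi_eq_Ioi hR.le
  have hf1 : IntegrableOn f (Set.Ioc 0 R) := by
    refine hi1.mono' (hf.mono_set Set.Ioc_subset_Ioi_self) ?_
    exact (ae_restrict_iff' measurableSet_Ioc).2 (Filter.Eventually.of_forall fun r hr =>
      (Real.norm_eq_abs _).trans_le (h1 r hr.1 hr.2))
  have hf2 : IntegrableOn f (Set.Ioi R) := by
    refine hi2.mono' (hf.mono_set (Set.Ioi_subset_Ioi hR.le)) ?_
    exact (ae_restrict_iff' measurableSet_Ioi).2 (Filter.Eventually.of_forall fun r hr =>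
      (Real.norm_eq_abs _).trans_le (h2 r hr))
  refine ⟨hu ▸ hf1.union hf2, ?_⟩
  rw [← hu, setIntegral_union (Set.Ioc_disjoint_Ioi le_rfl) measurableSet_Ioi hf1 hf2, ← hv1, ← hv2]
  refine (abs_add_le _ _).trans (add_le_add ?_ ?_)
  · exact norm_integral_le_of_norm_le hi1 ((ae_restrict_iff' measurableSet_Ioc).2
      (Filter.Eventually.of_forall fun r hr =>
      (Real.norm_eq_abs _).trans_le (h1 r hr.1 hr.2)))
  · exact norm_integral_le_of_norm_le hi2 ((ae_restrict_iff' measurableSet_Ioi).2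
      (Filter.Eventually.of_forall fun r hr =>
      (Real.norm_eq_abs _).trans_le (h2 r hr)))

lemma one_sub_exp_neg_bounds {x : ℝ} (hx : 0 ≤ x) :
    0 ≤ 1 - Real.exp (-x) ∧ 1 - Real.exp (-x) ≤ x ∧ 1 - Real.exp (-x) ≤ 1 :=
  ⟨by simpa using hx, by linarith [Real.add_one_le_exp (-x)], by linarith [Real.exp_pos (-x)]⟩

/-- The constant in the subordination formula for the power `s ^ β`. -/
noncomputable def powerConst (β : ℝ) : ℝ :=
  ∫ r in Set.Ioi 0, (1 - Real.exp (-r)) * r ^ (-1 - β)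

lemma integrableOn_powerKernel {β s : ℝ} (hβ : 0 < β) (hβ1 : β < 1) (hs : 0 ≤ s) :
    IntegrableOn (fun r => (1 - Real.exp (-(s * r))) * r ^ (-1 - β)) (Set.Ioi 0) := by
  refine (integrableOn_of_two_powers (A := s) (B := 1) (a := -β) (b := -1 - β) one_pos
    (by linarith) (by linarith) (by fun_prop) ?_ ?_).1
  · intro r hr _
    obtain ⟨h1, h2, _⟩ := one_sub_exp_neg_bounds (mul_nonneg hs hr.le)
    rw [abs_mul, abs_of_nonneg h1, abs_of_nonneg (by positivity)]
    calc _ ≤ s * r * r ^ (-1 - β) := by gcongr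
      _ = s * (r ^ (1 : ℝ) * r ^ (-1 - β)) := by rw [Real.rpow_one]; ring
      _ = _ := by rw [← Real.rpow_add hr]; ring_nf
  · intro r hr
    have hr : 0 < r := one_pos.trans hr
    obtain ⟨h1, _, h3⟩ := one_sub_exp_neg_bounds (mul_nonneg hs hr.le)
    rw [abs_mul, abs_of_nonneg h1, abs_of_nonneg (by positivity)]
    gcongr

lemma integral_powerKernel {β s : ℝ} (hβ : 0 < β) (hs : 0 ≤ s) :
    ∫ r in Set.Ioi 0, (1 - Real.exp (-(s * r))) * r ^ (-1 - β) = powerConst β * s ^ β := by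
  rcases hs.eq_or_lt with rfl | hs
  · simp [Real.zero_rpow hβ.ne']
  · have h := integral_comp_mul_left_Ioi (fun r => (1 - Real.exp (-r)) * r ^ (-1 - β)) 0 hs
    rw [mul_zero, smul_eq_mul] at h
    have h2 : ∀ r ∈ Set.Ioi (0 : ℝ), (1 - Real.exp (-(s * r))) * r ^ (-1 - β) =
        s ^ (1 + β) * ((1 - Real.exp (-(s * r))) * (s * r) ^ (-1 - β)) := fun r hr => by
      rw [Real.mul_rpow hs.le (le_of_lt hr)]
      have : s ^ (1 + β) * s ^ (-1 - β) = 1 := by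
        rw [← Real.rpow_add hs]; simp
      linear_combination -((1 - Real.exp (-(s * r))) * r ^ (-1 - β)) * this
    rw [setIntegral_congr_fun measurableSet_Ioi h2, integral_const_mul, h, ← powerConst,
      Real.rpow_add hs, Real.rpow_one]
    field_simp

lemma powerConst_pos {β : ℝ} (hβ : 0 < β) (hβ1 : β < 1) : 0 < powerConst β := by
  have hi := integrableOn_powerKernel hβ hβ1 zero_le_one
  simp only [one_mul] at hi
  rw [powerConst, setIntegral_pos_iff_support_of_nonneg_ae _ hi]
  · refine lt_of_lt_of_le (by simp : 0 < volume (Set.Ioi (0 : ℝ))) (measure_mono fun r hr => ?_)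
    have hr0 : 0 < r := hr
    refine ⟨?_, hr⟩
    have : Real.exp (-r) < 1 := by simpa using hr0
    exact (mul_pos (by linarith) (Real.rpow_pos_of_pos hr0 _)).ne'
  · refine (ae_restrict_iff' measurableSet_Ioi).2 (Filter.Eventually.of_forall fun r hr => ?_)
    have hr0 : 0 < r := hr
    exact mul_nonneg (one_sub_exp_neg_bounds hr0.le).1 (by positivity)

/-- The constant relating the Gaussian average over time to the power `u ^ (-1 - 2β)`. -/
noncomputable def timeConst (β : ℝ) : ℝ := ∫ τ in Set.Ioi 0, τ ^ (-1 - β) * heatLine τ 1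

/-- The first bound gives convergence of `timeConst` at infinity, the second at zero. The `32` comes
from `exp (-x) ≤ 2 / x ^ 2` at `x = 1 / (4τ)`. -/
lemma heatLine_one_bounds {τ : ℝ} (hτ : 0 < τ) :
    heatLine τ 1 ≤ τ ^ (-(1 / 2) : ℝ) ∧ heatLine τ 1 ≤ 32 * τ ^ (3 / 2 : ℝ) := by
  have h1 : (√(4 * Real.pi * τ))⁻¹ ≤ τ ^ (-(1 / 2) : ℝ) := by
    rw [Real.rpow_neg hτ.le, ← Real.sqrt_eq_rpow]
    have : √τ ≤ √(4 * Real.pi * τ) := Real.sqrt_le_sqrt (by nlinarith [Real.pi_gt_three])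
    have h0 : 0 < √τ := Real.sqrt_pos.2 hτ
    gcongr
  have h2 : Real.exp (-1 ^ 2 / (4 * τ)) ≤ 1 := by
    rw [Real.exp_le_one_iff]
    exact div_nonpos_of_nonpos_of_nonneg (by norm_num) (by positivity)
  have h3 : Real.exp (-1 ^ 2 / (4 * τ)) ≤ 32 * τ ^ (2 : ℝ) := by
    have := Real.pow_div_factorial_le_exp (1 / (4 * τ)) (by positivity) 2
    rw [show -1 ^ 2 / (4 * τ) = -(1 / (4 * τ)) by ring, Real.exp_neg]
    refine (inv_anti₀ (by positivity) this).trans (le_of_eq ?_)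
    rw [Real.rpow_two]
    simp [Nat.factorial]
    field_simp
    norm_num
  refine ⟨?_, ?_⟩
  · rw [heatLine]
    calc _ ≤ τ ^ (-(1 / 2) : ℝ) * 1 := by gcongr
      _ = _ := mul_one _
  · rw [heatLine]
    calc _ ≤ τ ^ (-(1 / 2) : ℝ) * (32 * τ ^ (2 : ℝ)) := by gcongr
      _ = 32 * (τ ^ (-(1 / 2) : ℝ) * τ ^ (2 : ℝ)) := by ring
      _ = _ := by rw [← Real.rpow_add hτ]; norm_num

lemma integrableOn_timeKernel {β : ℝ} (hβ : 0 < β) (hβ1 : β < 1) :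
    IntegrableOn (fun τ => τ ^ (-1 - β) * heatLine τ 1) (Set.Ioi 0) := by
  have hm : Measurable (fun τ => heatLine τ 1) :=
    measurable_heatLine.comp (measurable_id.prodMk measurable_const)
  refine (integrableOn_of_two_powers (A := 32) (B := 1) (a := 1 / 2 - β) (b := -3 / 2 - β) one_pos
    (by linarith) (by linarith) (by fun_prop) ?_ ?_).1
  · intro r hr _
    rw [abs_of_nonneg (mul_nonneg (by positivity) (heatLine_nonneg _ _))]
    calc _ ≤ r ^ (-1 - β) * (32 * r ^ (3 / 2 : ℝ)) := by gcongr; exact (heatLine_one_bounds hr).2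
      _ = 32 * (r ^ (-1 - β) * r ^ (3 / 2 : ℝ)) := by ring
      _ = _ := by rw [← Real.rpow_add hr]; ring_nf
  · intro r hr
    have hr : 0 < r := one_pos.trans hr
    rw [abs_of_nonneg (mul_nonneg (by positivity) (heatLine_nonneg _ _))]
    calc _ ≤ r ^ (-1 - β) * r ^ (-(1 / 2) : ℝ) := by gcongr; exact (heatLine_one_bounds hr).1
      _ = _ := by rw [← Real.rpow_add hr]; ring_nf

lemma timeConst_pos {β : ℝ} (hβ : 0 < β) (hβ1 : β < 1) : 0 < timeConst β := by
  rw [timeConst, setIntegral_pos_iff_support_of_nonneg_ae _ (integrableOn_timeKernel hβ hβ1)]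
  · refine lt_of_lt_of_le (by simp : 0 < volume (Set.Ioi (0 : ℝ))) (measure_mono fun r hr => ?_)
    have hr0 : 0 < r := hr
    refine ⟨?_, hr⟩
    have : 0 < heatLine r 1 := by unfold heatLine; positivity
    exact (mul_pos (Real.rpow_pos_of_pos hr0 _) this).ne'
  · refine (ae_restrict_iff' measurableSet_Ioi).2 (Filter.Eventually.of_forall fun r hr => ?_)
    have hr0 : 0 < r := hr
    exact mul_nonneg (by positivity) (heatLine_nonneg _ _)

lemma heatLine_scale {u τ : ℝ} (hu : 0 < u) (hτ : 0 < τ) :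
    heatLine (u ^ 2 * τ) u = u⁻¹ * heatLine τ 1 := by
  unfold heatLine
  rw [show 4 * Real.pi * (u ^ 2 * τ) = u ^ 2 * (4 * Real.pi * τ) by ring,
    Real.sqrt_mul (by positivity), Real.sqrt_sq hu.le, mul_inv, mul_assoc]
  congr 3
  field_simp

/-- Parabolic scaling `τ ↦ u² τ` reduces to `u = 1`; this is where the exponent `1 + α` comes from.
-/
lemma lintegral_timeKernel {β u : ℝ} (hβ : 0 < β) (hβ1 : β < 1) (hu : 0 < u) :
    ∫⁻ τ in Set.Ioi 0, ENNReal.ofReal (τ ^ (-1 - β) * heatLine τ u) =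
      ENNReal.ofReal (timeConst β * u ^ (-(1 + 2 * β))) := by
  have hu2 : 0 < u ^ 2 := by positivity
  have hsc : ∀ τ ∈ Set.Ioi (0 : ℝ), (u ^ 2 * τ) ^ (-1 - β) * heatLine (u ^ 2 * τ) u =
      u ^ (-(3 + 2 * β)) * (τ ^ (-1 - β) * heatLine τ 1) := fun τ hτ => by
    have hτ : 0 < τ := hτ
    rw [heatLine_scale hu hτ, Real.mul_rpow hu2.le hτ.le, ← Real.rpow_natCast,
      ← Real.rpow_mul hu.le, show -(3 + 2 * β) = ((2 : ℕ) : ℝ) * (-1 - β) + (-1) by push_cast; ring,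
      Real.rpow_add hu, Real.rpow_neg_one]
    ring
  have hint : IntegrableOn (fun τ => τ ^ (-1 - β) * heatLine τ u) (Set.Ioi 0) := by
    have := integrableOn_Ioi_comp_mul_left_iff (fun τ => τ ^ (-1 - β) * heatLine τ u) 0 hu2
    rw [mul_zero] at this
    rw [← this]
    have h := (integrableOn_timeKernel hβ hβ1).const_mul (u ^ (-(3 + 2 * β)))
    exact IntegrableOn.congr_fun h
      (fun τ hτ => (hsc τ hτ).symm) measurableSet_Ioi
  rw [← ofReal_integral_eq_lintegral_ofReal hint]
  · congr 1
    have h := integral_comp_mul_left_Ioi (fun τ => τ ^ (-1 - β) * heatLine τ u) 0 hu2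
    rw [mul_zero, smul_eq_mul, setIntegral_congr_fun measurableSet_Ioi hsc, integral_const_mul,
      ← timeConst, eq_comm, inv_mul_eq_iff_eq_mul₀ hu2.ne'] at h
    rw [h, show -(3 + 2 * β) = -(1 + 2 * β) + (-(2 : ℕ) : ℝ) by push_cast; ring, Real.rpow_add hu,
      Real.rpow_neg hu.le, Real.rpow_neg hu.le, Real.rpow_natCast]
    field_simp
  · refine (ae_restrict_iff' measurableSet_Ioi).2 (Filter.Eventually.of_forall fun r hr => ?_)
    have hr0 : 0 < r := hr
    exact mul_nonneg (by positivity) (heatLine_nonneg _ _)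

/-! ### Occupation and overshoot of the stable subordinator. -/

/-- The unnormalised overshoot density of the `β`-stable subordinator past the level `h`. -/
noncomputable def overshoot (β h v : ℝ) : ℝ := v ^ (-β) * (v + h)⁻¹

lemma measurable_overshoot (β h : ℝ) : Measurable (overshoot β h) := by
  unfold overshoot; fun_prop

lemma overshoot_nonneg {β h v : ℝ} (hh : 0 < h) (hv : 0 < v) : 0 ≤ overshoot β h v := by
  unfold overshoot; positivity

lemma integrableOn_overshoot {β h : ℝ} (hβ : 0 < β) (hβ1 : β < 1) (hh : 0 < h) :
    IntegrableOn (overshoot β h) (Set.Ioi 0) := by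
  refine (integrableOn_of_two_powers (A := h⁻¹) (B := 1) (a := -β) (b := -1 - β) one_pos
    (by linarith) (by linarith) (measurable_overshoot β h).aestronglyMeasurable ?_ ?_).1
  · intro r hr _
    rw [abs_of_nonneg (overshoot_nonneg hh hr), overshoot, mul_comm]
    gcongr
    linarith
  · intro r hr
    have hr : 0 < r := one_pos.trans hr
    rw [abs_of_nonneg (overshoot_nonneg hh hr), overshoot]
    calc _ ≤ r ^ (-β) * r⁻¹ := by gcongr; linarith
      _ = r ^ (-β) * r ^ (-1 : ℝ) := by rw [Real.rpow_neg_one]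
      _ = _ := by rw [← Real.rpow_add hr, one_mul]; ring_nf

lemma integrableOn_overshoot_exp {β h s : ℝ} (hβ : 0 < β) (hβ1 : β < 1) (hh : 0 < h)
    (hs : 0 ≤ s) :
    IntegrableOn (fun v => overshoot β h v * Real.exp (-((v + h) * s))) (Set.Ioi 0) := by
  refine (integrableOn_overshoot hβ hβ1 hh).mono'
    ((measurable_overshoot β h).mul (by fun_prop)).aestronglyMeasurable
    ((ae_restrict_iff' measurableSet_Ioi).2 (Filter.Eventually.of_forall fun v hv => ?_))
  have hv : 0 < v := hv
  rw [Real.norm_of_nonneg (mul_nonneg (overshoot_nonneg hh hv) (Real.exp_pos _).le)]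
  refine mul_le_of_le_one_right (overshoot_nonneg hh hv) ?_
  rw [Real.exp_le_one_iff, neg_nonpos]
  positivity

lemma integral_exp_neg_mul_Ioi {a s : ℝ} (ha : 0 < a) :
    IntegrableOn (fun u => Real.exp (-(a * u))) (Set.Ioi s) ∧
      ∫ u in Set.Ioi s, Real.exp (-(a * u)) = a⁻¹ * Real.exp (-(a * s)) := by
  have h1 := integrableOn_exp_mul_Ioi (neg_lt_zero.2 ha) s
  have h2 := integral_exp_mul_Ioi (neg_lt_zero.2 ha) s
  simp only [neg_mul] at h1 h2
  refine ⟨h1, h2.trans ?_⟩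
  field_simp

/-- Write `(v + h)⁻¹ exp (-(v + h) s)` as `∫ exp (-(v + h) u) du` over `u > s`; after Fubini the
`v`-integral is a Gamma integral. The result is the tail of the integral whose initial piece is
rescaled in `integral_power_exp_rescale`, and the two pieces add up to `Γ(β) h^(-β)`. -/
lemma integral_overshoot_exp_eq_tail {β h s : ℝ} (hβ : 0 < β) (hβ1 : β < 1) (hh : 0 < h)
    (hs : 0 ≤ s) :
    ∫ v in Set.Ioi 0, overshoot β h v * Real.exp (-((v + h) * s)) =
      Real.Gamma (1 - β) * ∫ u in Set.Ioi s, u ^ (β - 1) * Real.exp (-(h * u)) := by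
  set F : ℝ → ℝ → ℝ := fun v u => v ^ (-β) * Real.exp (-((v + h) * u)) with hF
  have hinner : ∀ v ∈ Set.Ioi (0 : ℝ), ∫ u in Set.Ioi s, F v u =
      overshoot β h v * Real.exp (-((v + h) * s)) := fun v hv => by
    have hv : 0 < v := hv
    simp only [hF]
    rw [integral_const_mul, (integral_exp_neg_mul_Ioi (by positivity)).2, overshoot]
    ring
  have houter : ∀ u ∈ Set.Ioi s, ∫ v in Set.Ioi 0, F v u =
      Real.Gamma (1 - β) * (u ^ (β - 1) * Real.exp (-(h * u))) := fun u hu => by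
    have hu : 0 < u := hs.trans_lt hu
    have h1 := Real.integral_rpow_mul_exp_neg_mul_Ioi (a := 1 - β) (by linarith) hu
    have h2 : ∀ v, F v u = Real.exp (-(h * u)) * (v ^ (1 - β - 1) * Real.exp (-(u * v))) := by
      intro v
      simp only [hF]
      rw [show -((v + h) * u) = -(h * u) + -(u * v) by ring, Real.exp_add,
        show 1 - β - 1 = -β by ring]
      ring
    simp_rw [h2]
    rw [integral_const_mul, h1, one_div, Real.inv_rpow hu.le, ← Real.rpow_neg hu.le,
      show -(1 - β) = β - 1 by ring]
    ring
  have hint : Integrable (Function.uncurry F)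
      ((volume.restrict (Set.Ioi 0)).prod (volume.restrict (Set.Ioi s))) := by
    have hm : Measurable (Function.uncurry F) := by
      simp only [hF, Function.uncurry_def]; fun_prop
    rw [integrable_prod_iff hm.aestronglyMeasurable]
    constructor
    · refine (ae_restrict_iff' measurableSet_Ioi).2 (Filter.Eventually.of_forall fun v hv => ?_)
      have hv : 0 < v := hv
      exact ((integral_exp_neg_mul_Ioi (a := v + h) (by positivity)).1).const_mul (v ^ (-β))
    · refine Integrable.congr (integrableOn_overshoot_exp hβ hβ1 hh hs)
        ((ae_restrict_iff' measurableSet_Ioi).2 (Filter.Eventually.of_forall fun v hv => ?_))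
      beta_reduce
      rw [← hinner v hv]
      have hv : 0 < v := hv
      congr 1 with u
      exact (Real.norm_of_nonneg (by simp only [hF]; positivity)).symm
  rw [← setIntegral_congr_fun measurableSet_Ioi hinner, integral_integral_swap hint,
    setIntegral_congr_fun measurableSet_Ioi houter, integral_const_mul]

lemma integral_power_exp_rescale {β h s : ℝ} (hβ : 0 < β) (hh : 0 < h) (hs : 0 ≤ s) :
    ∫ u in Set.Ioc 0 s, u ^ (β - 1) * Real.exp (-(h * u)) =
      (s / h) ^ β * ∫ t in Set.Ioc 0 h, t ^ (β - 1) * Real.exp (-(t * s)) := by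
  rcases hs.eq_or_lt with rfl | hs
  · simp [Real.zero_rpow hβ.ne']
  have hc : 0 < s / h := by positivity
  have h1 := intervalIntegral.integral_comp_mul_left (a := 0) (b := h)
    (fun u => u ^ (β - 1) * Real.exp (-(h * u))) hc.ne'
  rw [mul_zero, div_mul_cancel₀ _ hh.ne', smul_eq_mul, intervalIntegral.integral_of_le hh.le,
    intervalIntegral.integral_of_le hs.le, eq_comm, inv_mul_eq_iff_eq_mul₀ hc.ne'] at h1
  rw [h1, ← integral_const_mul, ← integral_const_mul]
  refine setIntegral_congr_fun measurableSet_Ioc fun t ht => ?_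
  have h2 : (s / h) * (s / h) ^ (β - 1) = (s / h) ^ β := by
    nth_rewrite 1 [← Real.rpow_one (s / h)]
    rw [← Real.rpow_add hc]; ring_nf
  rw [Real.mul_rpow hc.le ht.1.le, ← h2, show h * (s / h * t) = t * s by field_simp]
  ring

lemma integrableOn_rpow_mul_exp {β h : ℝ} (hβ : 0 < β) (hh : 0 < h) :
    IntegrableOn (fun u => u ^ (β - 1) * Real.exp (-(h * u))) (Set.Ioi 0) := by
  have h0 := Real.integral_rpow_mul_exp_neg_mul_Ioi hβ hh
  -- A non-integrable function has integral `0` by convention, which contradicts the positive Gamma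
  -- value.
  by_contra hcon
  rw [integral_undef hcon] at h0
  have : 0 < (1 / h) ^ β * Real.Gamma β := by
    have := Real.Gamma_pos_of_pos hβ
    positivity
  linarith

/-- Laplace transforms of the occupation and overshoot densities of the stable subordinator. -/
lemma rpow_mul_integral_exp {β h s : ℝ} (hβ : 0 < β) (hβ1 : β < 1) (hh : 0 < h) (hs : 0 ≤ s) :
    s ^ β * ∫ t in Set.Ioc 0 h, t ^ (β - 1) * Real.exp (-(t * s)) =
      Real.Gamma β - h ^ β / Real.Gamma (1 - β) *
        ∫ v in Set.Ioi 0, overshoot β h v * Real.exp (-((v + h) * s)) := by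
  have hG : 0 < Real.Gamma (1 - β) := Real.Gamma_pos_of_pos (by linarith)
  have h0 := Real.integral_rpow_mul_exp_neg_mul_Ioi hβ hh
  have hi := integrableOn_rpow_mul_exp hβ hh
  rw [← Set.Ioc_union_Ioi_eq_Ioi hs, setIntegral_union (Set.Ioc_disjoint_Ioi le_rfl)
    measurableSet_Ioi (hi.mono_set Set.Ioc_subset_Ioi_self) (hi.mono_set (Set.Ioi_subset_Ioi hs)),
    integral_power_exp_rescale hβ hh hs, Real.div_rpow hs hh.le, one_div,
    Real.inv_rpow hh.le] at h0
  rw [integral_overshoot_exp_eq_tail hβ hβ1 hh hs]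
  have hhβ : 0 < h ^ β := Real.rpow_pos_of_pos hh _
  generalize ∫ t in Set.Ioc 0 h, t ^ (β - 1) * Real.exp (-(t * s)) = a at *
  generalize ∫ u in Set.Ioi s, u ^ (β - 1) * Real.exp (-(h * u)) = b at *
  field_simp at h0 ⊢
  linarith

/-- The Laplace identity at `s = 0`; it lets the constant `ω ξ` cancel later. -/
lemma overshoot_mass {β h : ℝ} (hβ : 0 < β) (hβ1 : β < 1) (hh : 0 < h) :
    h ^ β / Real.Gamma (1 - β) * ∫ v in Set.Ioi 0, overshoot β h v = Real.Gamma β := by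
  have := rpow_mul_integral_exp hβ hβ1 hh le_rfl
  simp only [Real.zero_rpow hβ.ne', zero_mul, mul_zero, neg_zero, Real.exp_zero, mul_one] at this
  linarith

/-! ### The fractional Laplacian of the heat kernel, through Fourier integrals. -/

/-- The character `ζ ↦ exp (2πi⟨ζ, z⟩)`. -/
noncomputable def planeChar (z ζ : Plane) : ℂ :=
  Complex.exp (2 * Real.pi * inner ℝ ζ z * Complex.I)

/-- The symbol of `-Δ`. -/
noncomputable def lapSymbol (ζ : Plane) : ℝ := (2 * Real.pi * ‖ζ‖) ^ 2

lemma lapSymbol_nonneg (ζ : Plane) : 0 ≤ lapSymbol ζ := sq_nonneg _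

lemma continuous_lapSymbol : Continuous lapSymbol := by unfold lapSymbol; fun_prop

lemma measurable_lapSymbol : Measurable lapSymbol := continuous_lapSymbol.measurable

lemma continuous_planeChar (z : Plane) : Continuous (planeChar z) := by
  unfold planeChar; fun_prop

lemma norm_planeChar (z ζ : Plane) : ‖planeChar z ζ‖ = 1 := by
  rw [planeChar, show (2 * Real.pi * inner ℝ ζ z * Complex.I : ℂ) =
    ((2 * Real.pi * inner ℝ ζ z : ℝ) : ℂ) * Complex.I by push_cast; ring]
  exact Complex.norm_exp_ofReal_mul_I _

lemma integral_planeChar_heat {t : ℝ} (ht : 0 < t) (z : Plane) :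
    ∫ ζ, planeChar z ζ * (Real.exp (-(t * lapSymbol ζ)) : ℂ) = (heat t z : ℂ) := by
  have := integral_fourier_heat ht z
  simp only [neg_mul] at this
  exact this

lemma integrable_exp_symbol {t : ℝ} (ht : 0 < t) :
    Integrable (fun ζ => Real.exp (-(t * lapSymbol ζ))) := by
  have := integrable_gauss_multiplier ht
  simp only [neg_mul] at this
  exact this

lemma integrable_planeChar_mul {b : Plane → ℝ} (hb : Integrable b) (z : Plane) :
    Integrable (fun ζ => planeChar z ζ * (b ζ : ℂ)) := by
  refine hb.norm.mono' ((continuous_planeChar z).aestronglyMeasurable.mul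
    (Complex.continuous_ofReal.comp_aestronglyMeasurable hb.aestronglyMeasurable)) (Filter.Eventually.of_forall fun ζ => ?_)
  rw [norm_mul, norm_planeChar, one_mul, Complex.norm_real]

lemma integrable_symbol_rpow {β t : ℝ} (hβ : 0 < β) (hβ1 : β < 1) (ht : 0 < t) :
    Integrable (fun ζ => lapSymbol ζ ^ β * Real.exp (-(t * lapSymbol ζ))) := by
  refine ((integrable_exp_symbol (half_pos ht)).const_mul (1 + 2 / t)).mono'
    (((measurable_lapSymbol.pow_const β).mul (by
      have := measurable_lapSymbol; fun_prop)).aestronglyMeasurable)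
    (Filter.Eventually.of_forall fun ζ => ?_)
  have hs := lapSymbol_nonneg ζ
  generalize lapSymbol ζ = s at *
  rw [Real.norm_of_nonneg (by positivity)]
  have h1 : s ^ β ≤ 1 + s := by
    rcases le_total s 1 with h | h
    · linarith [Real.rpow_le_one hs h hβ.le]
    · have := Real.rpow_le_rpow_of_exponent_le h hβ1.le
      rw [Real.rpow_one] at this
      linarith
  have h2 : s ≤ 2 / t * Real.exp (t / 2 * s) := by
    have := Real.add_one_le_exp (t / 2 * s)
    rw [div_mul_eq_mul_div, le_div_iff₀ ht]
    linarith
  have h3 : 1 ≤ Real.exp (t / 2 * s) := Real.one_le_exp (by positivity)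
  calc s ^ β * Real.exp (-(t * s)) ≤ ((1 + 2 / t) * Real.exp (t / 2 * s)) * Real.exp (-(t * s)) := by
        gcongr
        linarith
    _ = (1 + 2 / t) * Real.exp (-(t / 2 * s)) := by
        rw [mul_assoc, ← Real.exp_add]
        congr 2
        ring

/-- Integrating inverse Fourier transforms in a parameter. -/
lemma integral_planeChar_swap (z : Plane) {S : Set ℝ} (hS : MeasurableSet S) {w : ℝ → ℝ}
    (hw : IntegrableOn w S) {k : ℝ → Plane → ℝ} (hk : Measurable (Function.uncurry k))
    {b : Plane → ℝ} (hb : Integrable b) (hkb : ∀ t ∈ S, ∀ ζ, |k t ζ| ≤ b ζ) :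
    Integrable (fun ζ => planeChar z ζ * ((∫ t in S, w t * k t ζ : ℝ) : ℂ)) ∧
      ∫ t in S, (w t : ℂ) * ∫ ζ, planeChar z ζ * (k t ζ : ℂ) =
        ∫ ζ, planeChar z ζ * ((∫ t in S, w t * k t ζ : ℝ) : ℂ) := by
  set F : ℝ → Plane → ℂ := fun t ζ => (w t : ℂ) * (planeChar z ζ * (k t ζ : ℂ)) with hF
  have hint : Integrable (Function.uncurry F) ((volume.restrict S).prod volume) := by
    have hprod := hw.norm.mul_prod hb
    refine hprod.mono' ?_ ?_
    · refine AEStronglyMeasurable.mul ?_ ?_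
      · exact (Complex.continuous_ofReal.comp_aestronglyMeasurable hw.aestronglyMeasurable).comp_fst
      · exact ((((continuous_planeChar z).comp continuous_snd).measurable).mul
          (Complex.measurable_ofReal.comp hk)).aestronglyMeasurable
    · have : ∀ᵐ p ∂((volume.restrict S).prod (volume : Measure Plane)), p.1 ∈ S :=
        Measure.quasiMeasurePreserving_fst.ae (ae_restrict_mem hS)
      filter_upwards [this] with p hp
      simp only [hF, Function.uncurry, norm_mul, norm_planeChar, one_mul, Complex.norm_real]
      exact mul_le_mul_of_nonneg_left (hkb p.1 hp p.2) (norm_nonneg _)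
  have hswap := integral_integral_swap hint
  have hr : ∀ ζ, ∫ t in S, F t ζ = planeChar z ζ * ((∫ t in S, w t * k t ζ : ℝ) : ℂ) := fun ζ => by
    rw [← integral_complex_ofReal, ← integral_const_mul]
    congr 1 with t
    simp only [hF]
    push_cast
    ring
  simp only [hr] at hswap
  refine ⟨?_, ?_⟩
  · have := hint.integral_prod_right
    simpa only [Function.uncurry, hr] using this
  · rw [← hswap]
    congr 1 with t
    simp only [hF]
    rw [integral_const_mul]

/-- The fractional Laplacian of order `2 β` of the heat kernel. -/
noncomputable def fracHeat (β t : ℝ) (z : Plane) : ℝ :=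
  (powerConst β)⁻¹ * ∫ r in Set.Ioi 0, (heat t z - heat (t + r) z) * r ^ (-1 - β)

/-- Subordination `s^β = κ⁻¹ ∫ (1 - exp (-s r)) r^(-1-β) dr`, with `κ = powerConst β`, under the
inverse Fourier integral. It replaces an oscillatory integral by time differences of heat kernels,
whose decay in `z` is explicit. -/
lemma integral_planeChar_rpow {β t : ℝ} (hβ : 0 < β) (hβ1 : β < 1) (ht : 0 < t) (z : Plane) :
    ∫ ζ, planeChar z ζ * ((lapSymbol ζ ^ β * Real.exp (-(t * lapSymbol ζ)) : ℝ) : ℂ) =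
      (fracHeat β t z : ℂ) := by
  have hκ := powerConst_pos hβ hβ1
  set F : ℝ → Plane → ℂ := fun r ζ => planeChar z ζ * (((Real.exp (-(t * lapSymbol ζ)) -
    Real.exp (-((t + r) * lapSymbol ζ))) * r ^ (-1 - β) : ℝ) : ℂ) with hF
  have hfac : ∀ r s : ℝ, (Real.exp (-(t * s)) - Real.exp (-((t + r) * s))) * r ^ (-1 - β) =
      Real.exp (-(t * s)) * ((1 - Real.exp (-(s * r))) * r ^ (-1 - β)) := fun r s => by
    rw [show -((t + r) * s) = -(t * s) + -(s * r) by ring, Real.exp_add]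
    ring
  have hreal : ∀ ζ, ∫ r in Set.Ioi 0, (Real.exp (-(t * lapSymbol ζ)) -
      Real.exp (-((t + r) * lapSymbol ζ))) * r ^ (-1 - β) =
      powerConst β * (lapSymbol ζ ^ β * Real.exp (-(t * lapSymbol ζ))) := fun ζ => by
    simp_rw [hfac]
    rw [integral_const_mul, integral_powerKernel hβ (lapSymbol_nonneg ζ)]
    ring
  have hint : Integrable (Function.uncurry F) ((volume.restrict (Set.Ioi 0)).prod volume) := by
    have hm : Measurable (Function.uncurry F) := by
      have h1 := (continuous_planeChar z).measurable
      have h2 := measurable_lapSymbol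
      simp only [hF, Function.uncurry_def]
      fun_prop
    rw [integrable_prod_iff' hm.aestronglyMeasurable]
    constructor
    · refine Filter.Eventually.of_forall fun ζ => ?_
      have h1 := (integrableOn_powerKernel hβ hβ1 (lapSymbol_nonneg ζ)).const_mul
        (Real.exp (-(t * lapSymbol ζ)))
      have h2 := (h1.ofReal (𝕜 := ℂ)).const_mul (planeChar z ζ)
      refine h2.congr (Filter.Eventually.of_forall fun r => ?_)
      simp only [hF, Function.uncurry, hfac]
      rfl
    · refine ((integrable_symbol_rpow hβ hβ1 ht).const_mul (powerConst β)).congr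
        (Filter.Eventually.of_forall fun ζ => ?_)
      beta_reduce
      rw [← hreal]
      refine setIntegral_congr_fun measurableSet_Ioi fun r hr => ?_
      have hr : 0 < r := hr
      simp only [hF, Function.uncurry, norm_mul, norm_planeChar, one_mul, Complex.norm_real, hfac]
      have h0 := (one_sub_exp_neg_bounds (mul_nonneg (lapSymbol_nonneg ζ) hr.le)).1
      rw [Real.norm_of_nonneg (Real.exp_pos _).le, Real.norm_of_nonneg h0,
        Real.norm_of_nonneg (by positivity)]
  have hswap := integral_integral_swap hint
  have hl : ∀ r ∈ Set.Ioi (0 : ℝ), ∫ ζ, F r ζ =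
      (((heat t z - heat (t + r) z) * r ^ (-1 - β) : ℝ) : ℂ) := fun r hr => by
    have hr : 0 < r := hr
    have h1 := integrable_planeChar_mul (integrable_exp_symbol ht) z
    have h2 := integrable_planeChar_mul (integrable_exp_symbol (t := t + r) (by positivity)) z
    push_cast
    rw [← integral_planeChar_heat ht z, ← integral_planeChar_heat (t := t + r) (by positivity) z,
      ← integral_sub h1 h2, ← integral_mul_const]
    congr 1 with ζ
    simp only [hF]
    push_cast
    ring
  have hr : ∀ ζ, ∫ r in Set.Ioi 0, F r ζ = (powerConst β : ℂ) * (planeChar z ζ *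
      ((lapSymbol ζ ^ β * Real.exp (-(t * lapSymbol ζ)) : ℝ) : ℂ)) := fun ζ => by
    simp only [hF]
    rw [integral_const_mul, integral_complex_ofReal, hreal]
    push_cast
    ring
  rw [setIntegral_congr_fun measurableSet_Ioi hl, integral_complex_ofReal] at hswap
  simp only [hr] at hswap
  rw [integral_const_mul] at hswap
  have hκ' : (powerConst β : ℂ) ≠ 0 := by exact_mod_cast hκ.ne'
  rw [fracHeat, Complex.ofReal_mul, hswap, Complex.ofReal_inv, inv_mul_cancel_left₀ hκ']

lemma fourier_heatSchwartz {t : ℝ} (ht : 0 < t) (x ζ : Plane) :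
    𝓕 (heatSchwartz t ht x : Plane → ℂ) ζ =
      planeChar (-x) ζ * (Real.exp (-(t * lapSymbol ζ)) : ℂ) := by
  have h := fourier_gaussian_innerProductSpace (V := Plane) (b := ((1 / (4 * t) : ℝ) : ℂ))
    (by rw [Complex.ofReal_re]; positivity) ζ
  rw [Real.fourier_eq'] at h ⊢
  simp only [heatSchwartz_apply]
  rw [← integral_add_right_eq_self _ x]
  have h2 : ∀ v : Plane, Complex.exp (↑(-2 * Real.pi * inner ℝ (v + x) ζ) * Complex.I) •
      (heat t (v + x - x) : ℂ) = planeChar (-x) ζ * (((4 * Real.pi * t)⁻¹ : ℝ) : ℂ) *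
      (Complex.exp (↑(-2 * Real.pi * inner ℝ v ζ) * Complex.I) •
        Complex.exp (-((1 / (4 * t) : ℝ) : ℂ) * (‖v‖ : ℂ) ^ 2)) := fun v => by
    have e1 : Complex.exp (↑(-2 * Real.pi * inner ℝ (v + x) ζ) * Complex.I) =
        planeChar (-x) ζ * Complex.exp (↑(-2 * Real.pi * inner ℝ v ζ) * Complex.I) := by
      rw [planeChar, ← Complex.exp_add, inner_add_left, inner_neg_right, real_inner_comm x ζ]
      congr 1
      push_cast
      ring
    have e2 : (heat t v : ℂ) = (((4 * Real.pi * t)⁻¹ : ℝ) : ℂ) *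
        Complex.exp (-((1 / (4 * t) : ℝ) : ℂ) * (‖v‖ : ℂ) ^ 2) := by
      rw [heat]
      push_cast
      congr 2
      ring
    rw [add_sub_cancel_right, e1, e2, smul_eq_mul, smul_eq_mul]
    ring
  simp_rw [h2]
  rw [integral_const_mul, h]
  have hpi : (Real.pi : ℂ) ≠ 0 := by exact_mod_cast Real.pi_ne_zero
  have ht' : (t : ℂ) ≠ 0 := by exact_mod_cast ht.ne'
  simp only [finrank_euclideanSpace, Fintype.card_fin, lapSymbol]
  push_cast
  rw [show (2 : ℂ) / 2 = 1 by norm_num, Complex.cpow_one, mul_assoc]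
  congr 1
  rw [← mul_assoc, show (4 * (Real.pi : ℂ) * t)⁻¹ * (Real.pi / (1 / (4 * t))) = 1 by field_simp,
    one_mul]
  congr 1
  field_simp
  ring

/-- The link with the distributional definition: heat kernels are the only test functions used. -/
lemma fracLapSchwartz_heatSchwartz {α t : ℝ} (hα : 0 < α) (hα2 : α < 2) (ht : 0 < t)
    (x z : Plane) :
    fracLapSchwartz α (heatSchwartz t ht x) z = (fracHeat (α / 2) t (z - x) : ℂ) := by
  rw [← integral_planeChar_rpow (by linarith) (by linarith) ht, fracLapSchwartz,
    Real.fourierInv_eq']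
  congr 1 with ζ
  rw [fourier_heatSchwartz, lapSymbol, ← Real.rpow_natCast, ← Real.rpow_mul (by positivity),
    show ((2 : ℕ) : ℝ) * (α / 2) = α by push_cast; ring]
  simp only [planeChar, inner_sub_right, inner_neg_right, smul_eq_mul]
  rw [show (2 * Real.pi * (inner ℝ ζ z - inner ℝ ζ x : ℝ) * Complex.I : ℂ) =
    ↑(2 * Real.pi * inner ℝ ζ z) * Complex.I + 2 * Real.pi * (-inner ℝ ζ x : ℝ) * Complex.I by
      push_cast; ring, Complex.exp_add]
  push_cast
  ring

lemma measurable_fracHeat (β : ℝ) : Measurable (fun p : ℝ × Plane => fracHeat β p.1 p.2) := by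
  have hm : Measurable (fun q : (ℝ × Plane) × ℝ =>
      (heat q.1.1 q.1.2 - heat (q.1.1 + q.2) q.1.2) * q.2 ^ (-1 - β)) := by
    have h1 : Measurable (fun q : (ℝ × Plane) × ℝ => heat q.1.1 q.1.2) :=
      measurable_heat.comp measurable_fst
    have h2 : Measurable (fun q : (ℝ × Plane) × ℝ => heat (q.1.1 + q.2) q.1.2) :=
      measurable_heat.comp (f := fun q : (ℝ × Plane) × ℝ =>
      (q.1.1 + q.2, q.1.2)) (by fun_prop)
    exact (h1.sub h2).mul (by fun_prop)
  exact (hm.stronglyMeasurable.integral_prod_right'.measurable).const_mul _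

lemma integrableOn_rpow_Ioc {β h : ℝ} (hβ : 0 < β) (hh : 0 < h) :
    IntegrableOn (fun t : ℝ => t ^ (β - 1)) (Set.Ioc 0 h) := by
  have := (intervalIntegral.intervalIntegrable_rpow' (a := 0) (b := h) (r := β - 1) (by linarith))
  rwa [intervalIntegrable_iff_integrableOn_Ioc_of_le hh.le] at this

lemma exp_neg_mul_symbol_le {a b : ℝ} (hab : a ≤ b) (ζ : Plane) :
    Real.exp (-(b * lapSymbol ζ)) ≤ Real.exp (-(a * lapSymbol ζ)) := by
  have := lapSymbol_nonneg ζ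
  gcongr

/-- Averaging `fracHeat` in time against the occupation density of the stable subordinator gives
the difference of the heat kernel and its average over the overshoot. -/
lemma integral_fracHeat {β h ε : ℝ} (hβ : 0 < β) (hβ1 : β < 1) (hh : 0 < h) (hε : 0 < ε)
    (z : Plane) :
    ∫ t in Set.Ioc 0 h, t ^ (β - 1) * fracHeat β (t + ε) z =
      Real.Gamma β * heat ε z - h ^ β / Real.Gamma (1 - β) *
        ∫ v in Set.Ioi 0, overshoot β h v * heat (v + h + ε) z := by
  have hm := measurable_lapSymbol
  obtain ⟨-, hA⟩ := integral_planeChar_swap z (S := Set.Ioc 0 h) measurableSet_Ioc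
    (integrableOn_rpow_Ioc hβ hh)
    (k := fun t ζ => lapSymbol ζ ^ β * Real.exp (-((t + ε) * lapSymbol ζ)))
    (by simp only [Function.uncurry_def]; fun_prop) (integrable_symbol_rpow hβ hβ1 hε)
    (fun t ht ζ => by
      have h0 := lapSymbol_nonneg ζ
      rw [abs_of_nonneg (by positivity)]
      exact mul_le_mul_of_nonneg_left (exp_neg_mul_symbol_le (by linarith [ht.1]) ζ)
        (by positivity))
  obtain ⟨hBi, hB⟩ := integral_planeChar_swap z (S := Set.Ioi 0) measurableSet_Ioi
    (integrableOn_overshoot hβ hβ1 hh)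
    (k := fun v ζ => Real.exp (-((v + h + ε) * lapSymbol ζ)))
    (by simp only [Function.uncurry_def]; fun_prop) (integrable_exp_symbol hε)
    (fun v hv ζ => by
      have hv : 0 < v := hv
      rw [abs_of_nonneg (Real.exp_pos _).le]
      exact exp_neg_mul_symbol_le (by linarith) ζ)
  have hA1 : ∀ t ∈ Set.Ioc 0 h, ((t ^ (β - 1) : ℝ) : ℂ) * ∫ ζ, planeChar z ζ *
      ((lapSymbol ζ ^ β * Real.exp (-((t + ε) * lapSymbol ζ)) : ℝ) : ℂ) =
      ((t ^ (β - 1) * fracHeat β (t + ε) z : ℝ) : ℂ) := fun t ht => by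
    rw [integral_planeChar_rpow hβ hβ1 (by linarith [ht.1]) z, Complex.ofReal_mul]
  have hB1 : ∀ v ∈ Set.Ioi (0 : ℝ), ((overshoot β h v : ℝ) : ℂ) * ∫ ζ, planeChar z ζ *
      (Real.exp (-((v + h + ε) * lapSymbol ζ)) : ℂ) =
      ((overshoot β h v * heat (v + h + ε) z : ℝ) : ℂ) := fun v hv => by
    have hv : 0 < v := hv
    rw [integral_planeChar_heat (by positivity) z, Complex.ofReal_mul]
  rw [setIntegral_congr_fun measurableSet_Ioc hA1, integral_complex_ofReal] at hA
  rw [setIntegral_congr_fun measurableSet_Ioi hB1, integral_complex_ofReal] at hB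
  -- The scalar Laplace identity at `s = lapSymbol ζ`, times `exp (-ε s)`. The shift by `ε` supplies
  -- the integrable majorants for the exchanges of integrals above.
  have hsym : ∀ ζ, ∫ t in Set.Ioc 0 h, t ^ (β - 1) * (lapSymbol ζ ^ β *
      Real.exp (-((t + ε) * lapSymbol ζ))) = Real.Gamma β * Real.exp (-(ε * lapSymbol ζ)) -
      h ^ β / Real.Gamma (1 - β) *
        ∫ v in Set.Ioi 0, overshoot β h v * Real.exp (-((v + h + ε) * lapSymbol ζ)) := fun ζ => by
    have key := rpow_mul_integral_exp hβ hβ1 hh (lapSymbol_nonneg ζ)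
    generalize lapSymbol ζ = s at *
    have e1 : ∀ t : ℝ, t ^ (β - 1) * (s ^ β * Real.exp (-((t + ε) * s))) =
        s ^ β * Real.exp (-(ε * s)) * (t ^ (β - 1) * Real.exp (-(t * s))) := fun t => by
      rw [show -((t + ε) * s) = -(ε * s) + -(t * s) by ring, Real.exp_add]; ring
    have e2 : ∀ v : ℝ, overshoot β h v * Real.exp (-((v + h + ε) * s)) =
        Real.exp (-(ε * s)) * (overshoot β h v * Real.exp (-((v + h) * s))) := fun v => by
      rw [show -((v + h + ε) * s) = -(ε * s) + -((v + h) * s) by ring, Real.exp_add]; ring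
    simp_rw [e1, e2]
    rw [integral_const_mul, integral_const_mul]
    linear_combination Real.exp (-(ε * s)) * key
  have hsplit : ∀ ζ, planeChar z ζ * ((∫ t in Set.Ioc 0 h, t ^ (β - 1) * (lapSymbol ζ ^ β *
      Real.exp (-((t + ε) * lapSymbol ζ))) : ℝ) : ℂ) =
      (Real.Gamma β : ℂ) * (planeChar z ζ * (Real.exp (-(ε * lapSymbol ζ)) : ℂ)) -
      ((h ^ β / Real.Gamma (1 - β) : ℝ) : ℂ) * (planeChar z ζ *
        ((∫ v in Set.Ioi 0, overshoot β h v * Real.exp (-((v + h + ε) * lapSymbol ζ)) : ℝ) : ℂ)) :=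
    fun ζ => by
      rw [hsym, Complex.ofReal_sub, Complex.ofReal_mul, Complex.ofReal_mul]
      ring
  simp only [hsplit] at hA
  rw [integral_sub ((integrable_planeChar_mul (integrable_exp_symbol hε) z).const_mul _)
    (hBi.const_mul _), integral_const_mul, integral_const_mul, ← hB,
    integral_planeChar_heat hε] at hA
  exact_mod_cast hA

/-! ### Decay of the heat kernel and of its fractional Laplacian. -/

lemma one_add_cube_mul_exp_neg_le {y : ℝ} (hy : 0 ≤ y) : (1 + y) ^ 3 * Real.exp (-y) ≤ 18 := by
  -- This yields the constant `3! * e < 18`.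
  have h1 := Real.pow_div_factorial_le_exp (1 + y) (by positivity) 3
  rw [Real.exp_add] at h1
  have h2 := Real.exp_one_lt_d9
  have h3 : Real.exp y * Real.exp (-y) = 1 := by rw [← Real.exp_add]; simp
  have h4 := Real.exp_pos y
  have h5 := Real.exp_pos (-y)
  have : (1 + y) ^ 3 ≤ 18 * Real.exp y := by
    simp only [Nat.factorial] at h1
    norm_num at h1
    nlinarith
  calc _ ≤ 18 * Real.exp y * Real.exp (-y) := by gcongr
    _ = 18 := by rw [mul_assoc, h3, mul_one]

lemma hasDerivAt_heat {τ : ℝ} (hτ : 0 < τ) (z : Plane) :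
    HasDerivAt (fun t => heat t z)
      ((4 * Real.pi)⁻¹ * (τ⁻¹ ^ 2 * (‖z‖ ^ 2 / (4 * τ) - 1) * Real.exp (-(‖z‖ ^ 2 / (4 * τ))))) τ := by
  have h1 : HasDerivAt (fun t : ℝ => (4 * Real.pi * t)⁻¹) (-(4 * Real.pi) / (4 * Real.pi * τ) ^ 2) τ := by
    have := ((hasDerivAt_id τ).const_mul (4 * Real.pi)).inv (by simp; positivity)
    simp only [mul_one, id] at this
    exact this
  have h2 : HasDerivAt (fun t : ℝ => -‖z‖ ^ 2 / (4 * t)) (‖z‖ ^ 2 * 4 / (4 * τ) ^ 2) τ := by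
    have := ((hasDerivAt_id τ).const_mul 4).inv (by simp; positivity) |>.const_mul (-‖z‖ ^ 2)
    refine (this.congr_deriv ?_)
    simp
    ring
  refine ((h1.mul h2.exp).congr_deriv ?_)
  rw [show -‖z‖ ^ 2 / (4 * τ) = -(‖z‖ ^ 2 / (4 * τ)) by ring]
  field_simp
  ring

/-- Trades each factor `τ⁻¹` for a gain of `(1 + ‖z‖²)⁻¹`, at the price of `1 + ‖z‖² / (4τ)`, which
the Gaussian absorbs. -/
lemma weight_div_le {ε τ : ℝ} (hε : 0 < ε) (hτ : ε ≤ τ) (z : Plane) :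
    (1 + ‖z‖ ^ 2) * τ⁻¹ ≤ (ε⁻¹ + 4) * (1 + ‖z‖ ^ 2 / (4 * τ)) := by
  have hτ0 : 0 < τ := hε.trans_le hτ
  have h1 : τ⁻¹ ≤ ε⁻¹ := inv_anti₀ hε hτ
  have h2 : 0 ≤ ‖z‖ ^ 2 / (4 * τ) := by positivity
  have h3 : (1 + ‖z‖ ^ 2) * τ⁻¹ = τ⁻¹ + 4 * (‖z‖ ^ 2 / (4 * τ)) := by field_simp
  have h4 : 0 ≤ ε⁻¹ * (‖z‖ ^ 2 / (4 * τ)) := by positivity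
  rw [h3]
  linarith

lemma four_pi_inv_le_one : (4 * Real.pi)⁻¹ ≤ 1 :=
  inv_le_one_of_one_le₀ (by nlinarith [Real.pi_gt_three])

lemma heat_mul_weight_le {ε τ : ℝ} (hε : 0 < ε) (hτ : ε ≤ τ) (z : Plane) :
    heat τ z ≤ 18 * (ε⁻¹ + 4) * (1 + ‖z‖ ^ 2)⁻¹ := by
  have hτ0 : 0 < τ := hε.trans_le hτ
  have hw := weight_div_le hε hτ z
  have hy : 0 ≤ ‖z‖ ^ 2 / (4 * τ) := by positivity
  have h18 := one_add_cube_mul_exp_neg_le hy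
  rw [heat, mul_inv, le_mul_inv_iff₀ (by positivity),
    show -‖z‖ ^ 2 / (4 * τ) = -(‖z‖ ^ 2 / (4 * τ)) by ring]
  generalize ‖z‖ ^ 2 / (4 * τ) = y at *
  have hE := Real.exp_pos (-y)
  have h1 : (1 + y) * Real.exp (-y) ≤ 18 :=
    le_trans (mul_le_mul_of_nonneg_right (le_self_pow₀ (by linarith) (by norm_num)) hE.le) h18
  calc (4 * Real.pi)⁻¹ * τ⁻¹ * Real.exp (-y) * (1 + ‖z‖ ^ 2)
      = (4 * Real.pi)⁻¹ * (((1 + ‖z‖ ^ 2) * τ⁻¹) * Real.exp (-y)) := by ring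
    _ ≤ 1 * (((ε⁻¹ + 4) * (1 + y)) * Real.exp (-y)) := by
        gcongr
        exact four_pi_inv_le_one
    _ = (ε⁻¹ + 4) * ((1 + y) * Real.exp (-y)) := by ring
    _ ≤ (ε⁻¹ + 4) * 18 := by gcongr
    _ = _ := by ring

/-- Mean value inequality in time: the time derivative carries a second factor `τ⁻¹`, hence a second
power of spatial decay. -/
lemma heat_diff_le {ε t r : ℝ} (hε : 0 < ε) (ht : ε ≤ t) (hr : 0 ≤ r) (z : Plane) :
    |heat t z - heat (t + r) z| ≤ 18 * (ε⁻¹ + 4) ^ 2 * (1 + ‖z‖ ^ 2)⁻¹ ^ 2 * r := by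
  have key := (convex_Ici ε).norm_image_sub_le_of_norm_hasDerivWithin_le
    (f := fun t => heat t z) (C := 18 * (ε⁻¹ + 4) ^ 2 * (1 + ‖z‖ ^ 2)⁻¹ ^ 2)
    (fun τ hτ => (hasDerivAt_heat (hε.trans_le hτ) z).hasDerivWithinAt) ?_
    (Set.mem_Ici.2 ht) (Set.mem_Ici.2 (by linarith : ε ≤ t + r))
  · rw [abs_sub_comm]
    simpa [abs_of_nonneg hr] using key
  · intro τ hτ
    have hτ : ε ≤ τ := hτ
    have hτ0 : 0 < τ := hε.trans_le hτ
    have hw := weight_div_le hε hτ z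
    have hy : 0 ≤ ‖z‖ ^ 2 / (4 * τ) := by positivity
    have h18 := one_add_cube_mul_exp_neg_le hy
    rw [Real.norm_eq_abs, inv_pow (1 + ‖z‖ ^ 2), le_mul_inv_iff₀ (by positivity)]
    generalize ‖z‖ ^ 2 / (4 * τ) = y at *
    have hE := Real.exp_pos (-y)
    have hy1 : |y - 1| ≤ 1 + y := abs_le.2 ⟨by linarith, by linarith⟩
    rw [abs_mul, abs_mul, abs_mul, abs_of_pos hE, abs_of_nonneg (by positivity : 0 ≤ τ⁻¹ ^ 2),
      abs_of_nonneg (by positivity : 0 ≤ (4 * Real.pi)⁻¹)]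
    calc (4 * Real.pi)⁻¹ * (τ⁻¹ ^ 2 * |y - 1| * Real.exp (-y)) * (1 + ‖z‖ ^ 2) ^ 2
        = (4 * Real.pi)⁻¹ * (((1 + ‖z‖ ^ 2) * τ⁻¹) ^ 2 * |y - 1| * Real.exp (-y)) := by ring
      _ ≤ 1 * (((ε⁻¹ + 4) * (1 + y)) ^ 2 * (1 + y) * Real.exp (-y)) := by
          gcongr
          exact four_pi_inv_le_one
      _ = (ε⁻¹ + 4) ^ 2 * ((1 + y) ^ 3 * Real.exp (-y)) := by ring
      _ ≤ (ε⁻¹ + 4) ^ 2 * 18 := by gcongr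
      _ = _ := by ring

/-- The decay of the fractional Laplacian of the heat kernel, locally uniformly in time. -/
lemma exists_abs_fracHeat_le {β ε : ℝ} (hβ : 0 < β) (hβ1 : β < 1) (hε : 0 < ε) :
    ∃ C, 0 ≤ C ∧ ∀ t, ε ≤ t → ∀ z, |fracHeat β t z| ≤ C * (1 + ‖z‖) ^ (-(2 + 2 * β)) := by
  have hκ := powerConst_pos hβ hβ1
  set K := 18 * (ε⁻¹ + 4) with hK
  set K2 := 18 * (ε⁻¹ + 4) ^ 2 with hK2
  have hK0 : 0 ≤ K := by positivity
  have hK20 : 0 ≤ K2 := by positivity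
  have h1β : 0 < 1 - β := by linarith
  refine ⟨(powerConst β)⁻¹ * (K2 / (1 - β) + 2 * K / β) * 2 ^ (1 + β), by positivity, fun t ht z => ?_⟩
  set ρ := 1 + ‖z‖ ^ 2 with hρ
  have hρ0 : 0 < ρ := by positivity
  have hm : AEStronglyMeasurable (fun r => (heat t z - heat (t + r) z) * r ^ (-1 - β))
      (volume.restrict (Set.Ioi 0)) := by
    have h2 : Measurable (fun r => heat (t + r) z) :=
      measurable_heat.comp (f := fun r : ℝ => (t + r, z)) (by fun_prop)
    fun_prop
  -- Cut at the parabolic time `r = ρ`, with the mean value bound below and the crude bound above;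
  -- both parts are then of order `ρ^(-1-β)`.
  have hb := (integrableOn_of_two_powers (A := K2 * ρ⁻¹ ^ 2) (B := 2 * K * ρ⁻¹) (a := -β)
    (b := -1 - β) hρ0 (by linarith) (by linarith) hm ?_ ?_).2
  · have e1 : ρ⁻¹ ^ 2 * ρ ^ (-β + 1) = ρ ^ (-(1 + β)) := by
      rw [← Real.rpow_neg_one, ← Real.rpow_natCast, ← Real.rpow_mul hρ0.le, ← Real.rpow_add hρ0]
      congr 1; push_cast; ring
    have e2 : ρ⁻¹ * ρ ^ (-1 - β + 1) = ρ ^ (-(1 + β)) := by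
      rw [← Real.rpow_neg_one, ← Real.rpow_add hρ0]
      congr 1; ring
    have e3 : K2 * ρ⁻¹ ^ 2 * (ρ ^ (-β + 1) / (-β + 1)) +
        2 * K * ρ⁻¹ * (-ρ ^ (-1 - β + 1) / (-1 - β + 1)) =
        (K2 / (1 - β) + 2 * K / β) * ρ ^ (-(1 + β)) := by
      calc _ = K2 / (1 - β) * (ρ⁻¹ ^ 2 * ρ ^ (-β + 1)) + 2 * K / β * (ρ⁻¹ * ρ ^ (-1 - β + 1)) := by
            rw [show -1 - β + 1 = -β by ring, show -β + 1 = 1 - β by ring]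
            field_simp
        _ = _ := by rw [e1, e2]; ring
    have e4 : ρ ^ (-(1 + β)) ≤ 2 ^ (1 + β) * (1 + ‖z‖) ^ (-(2 + 2 * β)) := by
      have h1 : (1 + ‖z‖) ^ 2 ≤ 2 * ρ := by
        rw [hρ]; nlinarith [sq_nonneg (‖z‖ - 1)]
      have h2 : (1 + ‖z‖) ^ (-(2 + 2 * β)) = ((1 + ‖z‖) ^ 2) ^ (-(1 + β)) := by
        rw [← Real.rpow_natCast, ← Real.rpow_mul (by positivity)]
        congr 1; push_cast; ring
      have h3 : (2 * ρ) ^ (-(1 + β)) ≤ ((1 + ‖z‖) ^ 2) ^ (-(1 + β)) :=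
        Real.rpow_le_rpow_of_nonpos (by positivity) h1 (by linarith)
      rw [h2]
      calc ρ ^ (-(1 + β)) = 2 ^ (1 + β) * (2 * ρ) ^ (-(1 + β)) := by
            rw [Real.mul_rpow (by norm_num) hρ0.le, ← mul_assoc, ← Real.rpow_add (by norm_num)]
            simp
        _ ≤ _ := by gcongr
    rw [e3] at hb
    rw [fracHeat, abs_mul, abs_of_pos (inv_pos.2 hκ)]
    calc _ ≤ (powerConst β)⁻¹ * ((K2 / (1 - β) + 2 * K / β) *
          (2 ^ (1 + β) * (1 + ‖z‖) ^ (-(2 + 2 * β)))) := by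
          gcongr
          exact hb.trans (by gcongr)
      _ = _ := by ring
  · intro r hr _
    rw [abs_mul, abs_of_nonneg (by positivity : 0 ≤ r ^ (-1 - β))]
    calc _ ≤ K2 * ρ⁻¹ ^ 2 * r * r ^ (-1 - β) := by
          gcongr
          exact heat_diff_le hε ht hr.le z
      _ = K2 * ρ⁻¹ ^ 2 * (r ^ (1 : ℝ) * r ^ (-1 - β)) := by rw [Real.rpow_one]; ring
      _ = _ := by rw [← Real.rpow_add hr]; ring_nf
  · intro r hr
    have hr : 0 < r := hρ0.trans hr
    rw [abs_mul, abs_of_nonneg (by positivity : 0 ≤ r ^ (-1 - β))]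
    gcongr
    have h1 := heat_mul_weight_le hε ht z
    have h2 := heat_mul_weight_le hε (by linarith : ε ≤ t + r) z
    have h3 := heat_nonneg (by linarith : 0 ≤ t) z
    have h4 := heat_nonneg (by linarith : 0 ≤ t + r) z
    rw [abs_le]
    constructor <;> linarith

/-! ### Convergence of the heat extension at points of continuity. -/

lemma heat_scale {c : ℝ} (hc : 0 < c) (z : Plane) :
    c ^ 2 * heat 1 (c • z) = heat ((c ^ 2)⁻¹) z := by
  rw [heat, heat, norm_smul, Real.norm_of_nonneg hc.le, mul_pow, mul_one, mul_one,
    show -(c ^ 2 * ‖z‖ ^ 2) / 4 = -‖z‖ ^ 2 / (4 * (c ^ 2)⁻¹) by field_simp]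
  field_simp

lemma tendsto_sq_norm_mul_heat :
    Filter.Tendsto (fun z : Plane => ‖z‖ ^ 2 * heat 1 z) (Bornology.cobounded Plane) (nhds 0) := by
  have h1 : Filter.Tendsto (fun z : Plane => ‖z‖ ^ 2 / 4) (Bornology.cobounded Plane) Filter.atTop :=
    ((Filter.tendsto_pow_atTop two_ne_zero).comp tendsto_norm_cobounded_atTop).atTop_div_const
      (by norm_num)
  have h2 := ((Real.tendsto_pow_mul_exp_neg_atTop_nhds_zero 1).comp h1).const_mul (Real.pi⁻¹)
  rw [mul_zero] at h2
  refine h2.congr fun z => ?_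
  simp only [Function.comp, heat, pow_one, mul_one]
  rw [neg_div, mul_inv]
  ring

lemma heat_le_far {t : ℝ} (ht : 0 < t) {z : Plane} (hz : z ≠ 0) :
    heat t z ≤ 288 / ‖z‖ ^ 4 * t := by
  have hz' : 0 < ‖z‖ := norm_pos_iff.2 hz
  have hy : 0 < ‖z‖ ^ 2 / (4 * t) := by positivity
  have h18 := one_add_cube_mul_exp_neg_le hy.le
  have hE := Real.exp_pos (-(‖z‖ ^ 2 / (4 * t)))
  have h1 : (‖z‖ ^ 2 / (4 * t)) ^ 2 * Real.exp (-(‖z‖ ^ 2 / (4 * t))) ≤ 18 := by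
    refine le_trans (mul_le_mul_of_nonneg_right ?_ hE.le) h18
    generalize ‖z‖ ^ 2 / (4 * t) = y at *
    nlinarith [pow_pos hy 3]
  rw [heat, mul_inv, neg_div]
  generalize Real.exp (-(‖z‖ ^ 2 / (4 * t))) = E at *
  have h2 : E ≤ 288 * t ^ 2 / ‖z‖ ^ 4 := by
    rw [le_div_iff₀ (by positivity)]
    calc E * ‖z‖ ^ 4 = 16 * t ^ 2 * ((‖z‖ ^ 2 / (4 * t)) ^ 2 * E) := by field_simp; ring
      _ ≤ 16 * t ^ 2 * 18 := by gcongr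
      _ = _ := by ring
  calc (4 * Real.pi)⁻¹ * t⁻¹ * E ≤ 1 * t⁻¹ * (288 * t ^ 2 / ‖z‖ ^ 4) := by
        gcongr
        exact four_pi_inv_le_one
    _ = _ := by field_simp

/-- Off the unit ball the exponent improves on that at time `1` by at least `(t⁻¹ - 1) / 4`, which
beats the prefactor `t⁻¹`. -/
lemma heat_le_heat_one {t : ℝ} (ht : 0 < t) (ht1 : t ≤ 1) {z : Plane} (hz : 1 ≤ ‖z‖) :
    heat t z ≤ 4 * Real.exp (1 / 4) * heat 1 z := by
  have hw : 1 ≤ t⁻¹ := (one_le_inv₀ ht).2 ht1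
  have h1 : t⁻¹ ≤ 4 * Real.exp (t⁻¹ / 4) := by
    have := Real.add_one_le_exp (t⁻¹ / 4)
    linarith
  have h2 : -‖z‖ ^ 2 / (4 * t) ≤ -(t⁻¹ / 4) + 1 / 4 + -‖z‖ ^ 2 / (4 * 1) := by
    have e : -‖z‖ ^ 2 / (4 * t) = -(‖z‖ ^ 2 * t⁻¹) / 4 := by field_simp
    rw [e]
    have : 1 ≤ ‖z‖ ^ 2 := one_le_pow₀ hz
    nlinarith [mul_nonneg (sub_nonneg.2 this) (sub_nonneg.2 hw)]
  rw [heat, heat, mul_inv]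
  calc (4 * Real.pi)⁻¹ * t⁻¹ * Real.exp (-‖z‖ ^ 2 / (4 * t))
      ≤ (4 * Real.pi)⁻¹ * (4 * Real.exp (t⁻¹ / 4)) *
        Real.exp (-(t⁻¹ / 4) + 1 / 4 + -‖z‖ ^ 2 / (4 * 1)) := by gcongr
    _ = 4 * Real.exp (1 / 4) * ((4 * Real.pi * 1)⁻¹ * Real.exp (-‖z‖ ^ 2 / (4 * 1))) := by
        rw [Real.exp_add, Real.exp_add, Real.exp_neg (t⁻¹ / 4)]
        field_simp

/-- Only Gaussian integrability of `f` is available. Inside the unit ball `f` is integrable and the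
heat kernel is an approximate identity; outside, `heat 1` dominates and the kernel tends to zero
pointwise. -/
lemma tendsto_integral_heat_zero {f : Plane → ℝ} (hf : Integrable (fun z => f z * heat 1 z))
    (hc : ContinuousAt f 0) :
    Filter.Tendsto (fun t => ∫ z, f z * heat t z) (nhdsWithin 0 (Set.Ioi 0)) (nhds (f 0)) := by
  set B : Set Plane := Metric.ball 0 1 with hB
  have hBm : MeasurableSet B := measurableSet_ball
  have hpos : ∀ z : Plane, 0 < heat 1 z := fun z => by unfold heat; positivity
  have hfm : AEStronglyMeasurable f := by
    have := hf.aestronglyMeasurable.mul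
      ((continuous_heat 1).inv₀ fun z => (hpos z).ne').aestronglyMeasurable
    refine this.congr (Filter.Eventually.of_forall fun z => ?_)
    simp only [Pi.mul_apply, Pi.inv_apply]
    rw [mul_assoc, mul_inv_cancel₀ (hpos z).ne', mul_one]
  have hin : Integrable (B.indicator f) := by
    refine (hf.norm.const_mul (4 * Real.pi * Real.exp (1 / 4))).mono' (hfm.indicator hBm)
      (Filter.Eventually.of_forall fun z => ?_)
    by_cases hz : z ∈ B
    · rw [Set.indicator_of_mem hz, norm_mul, Real.norm_of_nonneg (hpos z).le]
      have hz1 : ‖z‖ < 1 := by simpa [hB] using hz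
      have h1 : 1 ≤ 4 * Real.pi * Real.exp (1 / 4) * heat 1 z := by
        rw [heat, show 4 * Real.pi * Real.exp (1 / 4) * ((4 * Real.pi * 1)⁻¹ *
          Real.exp (-‖z‖ ^ 2 / (4 * 1))) = Real.exp (1 / 4) * Real.exp (-‖z‖ ^ 2 / (4 * 1)) by
            field_simp, ← Real.exp_add]
        apply Real.one_le_exp
        nlinarith [norm_nonneg z]
      calc ‖f z‖ = ‖f z‖ * 1 := (mul_one _).symm
        _ ≤ ‖f z‖ * (4 * Real.pi * Real.exp (1 / 4) * heat 1 z) := by gcongr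
        _ = _ := by ring
    · rw [Set.indicator_of_notMem hz, norm_zero]
      positivity
  have hev : B.indicator f =ᶠ[nhds 0] f := by
    filter_upwards [Metric.ball_mem_nhds (0 : Plane) one_pos] with z hz
    exact Set.indicator_of_mem hz f
  have hnear : Filter.Tendsto (fun t => ∫ z, B.indicator f z * heat t z)
      (nhdsWithin 0 (Set.Ioi 0)) (nhds (f 0)) := by
    have h1 := tendsto_integral_comp_smul_smul_of_integrable (μ := (volume : Measure Plane))
      (φ := heat 1) (fun z => (hpos z).le) (integral_heat one_pos)
      (by simpa using tendsto_sq_norm_mul_heat) hin (hc.congr hev.symm)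
    rw [hev.eq_of_nhds] at h1
    have h2 : Filter.Tendsto (fun t : ℝ => √(t⁻¹)) (nhdsWithin 0 (Set.Ioi 0)) Filter.atTop :=
      Real.tendsto_sqrt_atTop.comp tendsto_inv_nhdsGT_zero
    refine (h1.comp h2).congr' ?_
    filter_upwards [self_mem_nhdsWithin] with t ht
    have ht : 0 < t := ht
    simp only [Function.comp, finrank_euclideanSpace, Fintype.card_fin, smul_eq_mul]
    congr 1 with z
    rw [heat_scale (Real.sqrt_pos.2 (inv_pos.2 ht)), Real.sq_sqrt (inv_pos.2 ht).le, inv_inv,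
      mul_comm]
  have hdom : ∀ t : ℝ, 0 < t → t ≤ 1 → ∀ z, ‖Bᶜ.indicator f z * heat t z‖ ≤
      4 * Real.exp (1 / 4) * ‖f z * heat 1 z‖ := fun t ht ht1 z => by
    by_cases hz : z ∈ Bᶜ
    · rw [Set.indicator_of_mem hz, norm_mul, norm_mul, Real.norm_of_nonneg (hpos z).le,
        Real.norm_of_nonneg (heat_nonneg ht.le z)]
      have hz1 : 1 ≤ ‖z‖ := by simpa [hB] using hz
      calc _ ≤ ‖f z‖ * (4 * Real.exp (1 / 4) * heat 1 z) := by
            gcongr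
            exact heat_le_heat_one ht ht1 hz1
        _ = _ := by ring
    · rw [Set.indicator_of_notMem hz, zero_mul, norm_zero]
      positivity
  have hmem : Set.Ioc (0 : ℝ) 1 ∈ nhdsWithin (0 : ℝ) (Set.Ioi 0) := Ioc_mem_nhdsGT one_pos
  have hmeas : ∀ t, AEStronglyMeasurable (fun z => Bᶜ.indicator f z * heat t z) := fun t =>
    (hfm.indicator hBm.compl).mul (continuous_heat t).aestronglyMeasurable
  have hfar : Filter.Tendsto (fun t => ∫ z, Bᶜ.indicator f z * heat t z)
      (nhdsWithin 0 (Set.Ioi 0)) (nhds (∫ _ : Plane, (0 : ℝ))) := by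
    refine tendsto_integral_filter_of_dominated_convergence
      (fun z => 4 * Real.exp (1 / 4) * ‖f z * heat 1 z‖) (Filter.Eventually.of_forall hmeas) ?_
      (hf.norm.const_mul _) (Filter.Eventually.of_forall fun z => ?_)
    · filter_upwards [hmem] with t ht
      exact Filter.Eventually.of_forall (hdom t ht.1 ht.2)
    · by_cases hz : z ∈ Bᶜ
      · have hz0 : z ≠ 0 := by
          rintro rfl
          exact hz (Metric.mem_ball_self one_pos)
        have hlim : Filter.Tendsto (fun t : ℝ => 288 / ‖z‖ ^ 4 * t) (nhdsWithin 0 (Set.Ioi 0))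
            (nhds 0) := by
          have : Filter.Tendsto (fun t : ℝ => 288 / ‖z‖ ^ 4 * t) (nhds 0)
              (nhds (288 / ‖z‖ ^ 4 * 0)) := Filter.tendsto_id.const_mul _
          rw [mul_zero] at this
          exact this.mono_left nhdsWithin_le_nhds
        suffices hz : Filter.Tendsto (fun t : ℝ => heat t z) (nhdsWithin 0 (Set.Ioi 0)) (nhds 0) by
          simpa using hz.const_mul (Bᶜ.indicator f z)
        refine tendsto_of_tendsto_of_tendsto_of_le_of_le' tendsto_const_nhds hlim ?_ ?_
        · filter_upwards [self_mem_nhdsWithin] with t ht using heat_nonneg (le_of_lt ht) z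
        · filter_upwards [self_mem_nhdsWithin] with t ht using heat_le_far ht hz0
      · simp only [Set.indicator_of_notMem hz, zero_mul]
        exact tendsto_const_nhds
  rw [integral_zero] at hfar
  have hsum := hnear.add hfar
  rw [add_zero] at hsum
  refine hsum.congr' ?_
  filter_upwards [hmem] with t ht
  rw [← integral_add]
  · congr 1 with z
    rw [← add_mul]
    congr 1
    exact congrFun (Set.indicator_self_add_compl B f) z
  · refine (hin.norm.const_mul (t⁻¹)).mono'
      (hin.aestronglyMeasurable.mul (continuous_heat t).aestronglyMeasurable)
      (Filter.Eventually.of_forall fun z => ?_)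
    rw [norm_mul, mul_comm, Real.norm_of_nonneg (heat_nonneg ht.1.le z)]
    refine mul_le_mul_of_nonneg_right ?_ (norm_nonneg _)
    have h0 : 0 < t := ht.1
    rw [heat, mul_inv]
    have h1 : Real.exp (-‖z‖ ^ 2 / (4 * t)) ≤ 1 := by
      rw [Real.exp_le_one_iff, neg_div, neg_nonpos]; positivity
    calc _ ≤ 1 * t⁻¹ * 1 := by
          gcongr
          exact four_pi_inv_le_one
      _ = _ := by ring
  · exact (hf.norm.const_mul _).mono' (hmeas t)
      (Filter.Eventually.of_forall (hdom t ht.1 ht.2))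

lemma tendsto_integral_heat {f : Plane → ℝ} {x : Plane}
    (hf : Integrable (fun z => f z * heat 1 (z - x))) (hc : ContinuousAt f x) :
    Filter.Tendsto (fun t => ∫ z, f z * heat t (z - x)) (nhdsWithin 0 (Set.Ioi 0))
      (nhds (f x)) := by
  have h1 := tendsto_integral_heat_zero (f := fun z => f (z + x))
    (by simpa using hf.comp_add_right x)
    (ContinuousAt.comp (g := f) (by rwa [zero_add]) (by fun_prop))
  rw [zero_add] at h1
  refine h1.congr fun t => ?_
  rw [← integral_add_right_eq_self (fun z => f z * heat t (z - x)) x]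
  simp only [add_sub_cancel_right]

/-! ### Reduction of the planar increment to the line. -/

lemma exists_orthonormalBasis_zero {e : Plane} (he : ‖e‖ = 1) :
    ∃ b : OrthonormalBasis (Fin 2) ℝ Plane, b 0 = e := by
  have hv : Orthonormal ℝ (({0} : Set (Fin 2)).domRestrict (fun _ => e)) := by
    rw [orthonormal_iff_ite]
    intro i j
    have : i = j := Subsingleton.elim _ _
    simp [this, he, Set.domRestrict]
  obtain ⟨b, hb⟩ := hv.exists_orthonormalBasis_extension_of_card_eq (by simp)
  exact ⟨b, hb 0 rfl⟩

/-- Integration over the plane in orthonormal coordinates. -/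
lemma exists_coordinates (b : OrthonormalBasis (Fin 2) ℝ Plane) :
    ∃ Φ : ℝ × ℝ ≃ᵐ Plane, MeasurePreserving Φ ∧ ∀ p, Φ p = p.1 • b 0 + p.2 • b 1 := by
  have h1 : MeasurePreserving (MeasurableEquiv.finTwoArrow (α := ℝ)).symm :=
    (volume_preserving_finTwoArrow ℝ).symm
  have h2 := EuclideanSpace.volume_preserving_symm_measurableEquiv_toLp (Fin 2)
  have h3 := b.repr.symm.measurePreserving
  refine ⟨((MeasurableEquiv.finTwoArrow (α := ℝ)).symm.trans
    (MeasurableEquiv.toLp 2 (Fin 2 → ℝ))).trans b.repr.symm.toMeasurableEquiv, ?_, fun p => ?_⟩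
  · exact (h3.comp (h2.symm.comp h1))
  · simp [← OrthonormalBasis.sum_repr_symm]

lemma HasModulus.continuous {θ : Plane → ℝ} {ω : ℝ → ℝ} (hθ : HasModulus θ ω) (h : IsModulus ω) :
    Continuous θ := by
  rw [continuous_iff_continuousAt]
  intro x
  rw [ContinuousAt, tendsto_iff_dist_tendsto_zero]
  have h1 := h.continuous_posPart (f := fun s => s) continuous_id
  have h2 : Filter.Tendsto (fun z => ω (max ‖z - x‖ 0)) (nhds x) (nhds 0) := by
    have h3 : Continuous (fun z : Plane => ω (max ‖z - x‖ 0)) :=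
      h1.comp (g := fun s => ω (max s 0)) (by fun_prop : Continuous fun z : Plane => ‖z - x‖)
    have := h3.tendsto x
    simpa [h.map_zero] using this
  refine squeeze_zero (fun _ => dist_nonneg) (fun z => ?_) h2
  rw [Real.dist_eq, max_eq_left (norm_nonneg _)]
  exact hθ z x

lemma HasModulus.abs_increment_le {θ : Plane → ℝ} {ω : ℝ → ℝ} (hθ : HasModulus θ ω)
    (x y z : Plane) : |θ (x + z) - θ (y + z)| ≤ ω ‖x - y‖ := by
  simpa using hθ (x + z) (y + z)

lemma HasModulus.integrable_increment {θ : Plane → ℝ} {ω : ℝ → ℝ} (hθ : HasModulus θ ω)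
    (h : IsModulus ω) (x y : Plane) {k : Plane → ℝ} (hk : Integrable k) :
    Integrable (fun z => (θ (x + z) - θ (y + z)) * k z) := by
  have hc := hθ.continuous h
  exact hk.bdd_mul (c := ω ‖x - y‖)
    (by fun_prop : Continuous fun z => θ (x + z) - θ (y + z)).aestronglyMeasurable
    (Filter.Eventually.of_forall fun z => hθ.abs_increment_le x y z)

lemma heat_coordinates {b : OrthonormalBasis (Fin 2) ℝ Plane} {τ : ℝ} (hτ : 0 < τ) (p q : ℝ) :
    heat τ (p • b 0 + q • b 1) = heatLine τ p * heatLine τ q := by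
  have h1 : ‖p • b 0 + q • b 1‖ ^ 2 = p ^ 2 + q ^ 2 := by
    have := b.sum_sq_norm_inner_right (p • b 0 + q • b 1)
    rw [← this]
    simp [inner_add_right, inner_smul_right, b.inner_eq_ite]
  have h2 : √(4 * Real.pi * τ) * √(4 * Real.pi * τ) = 4 * Real.pi * τ :=
    Real.mul_self_sqrt (by positivity)
  have h3 : (4 * Real.pi * τ)⁻¹ = (√(4 * Real.pi * τ))⁻¹ * (√(4 * Real.pi * τ))⁻¹ := by
    rw [← mul_inv, h2]
  rw [heat, heatLine, heatLine, h1, h3,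
    show -(p ^ 2 + q ^ 2) / (4 * τ) = -p ^ 2 / (4 * τ) + -q ^ 2 / (4 * τ) by ring, Real.exp_add]
  ring

/-- The Gaussian average of an increment is controlled by the modulus of continuity. -/
lemma HasModulus.integral_increment_heat_le {θ : Plane → ℝ} {ω : ℝ → ℝ} (hθ : HasModulus θ ω)
    (h : IsModulus ω) {x y : Plane} {ξ τ : ℝ} (hxy : ‖x - y‖ = ξ) (hξ : 0 < ξ) (hτ : 0 < τ) :
    ∫ z, (θ (x + z) - θ (y + z)) * heat τ z ≤
      ω ξ + ∫ u in Set.Ioi 0, heatLine τ u * modulusGap ω ξ u := by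
  have he : ‖ξ⁻¹ • (x - y)‖ = 1 := by
    rw [norm_smul, norm_inv, Real.norm_of_nonneg hξ.le, hxy, inv_mul_cancel₀ hξ.ne']
  obtain ⟨b, hb⟩ := exists_orthonormalBasis_zero he
  obtain ⟨Φ, hΦ, hΦa⟩ := exists_coordinates b
  have hd : x - y = ξ • b 0 := by rw [hb, smul_smul, mul_inv_cancel₀ hξ.ne', one_smul]
  -- The midpoint of `x` and `y`, so that they sit at `±ξ/2` along `b 0`.
  set m : Plane := y + (ξ / 2) • b 0 with hm
  have hy : y = m + (-(ξ / 2)) • b 0 := by rw [hm, neg_smul, add_neg_cancel_right]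
  have hx : x = m + (ξ / 2) • b 0 := by
    rw [hm, add_assoc, ← add_smul, add_halves, ← hd, add_sub_cancel]
  set C := ω ξ + ∫ u in Set.Ioi 0, heatLine τ u * modulusGap ω ξ u with hC
  set f : ℝ → ℝ → ℝ := fun q s => θ (m + s • b 0 + q • b 1) with hf
  have hcont := hθ.continuous h
  -- On every line parallel to `x - y` the restriction of `θ` has modulus `ω`; the bound does not
  -- depend on the line, and the transverse Gaussian has mass one.
  have hline : ∀ q, ∫ p, heatLine τ p * (f q (p + ξ / 2) - f q (p - ξ / 2)) ≤ C := fun q => by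
    refine (h.heatLine_increment_le (f := f q) (by simp only [hf]; fun_prop) (fun r s => ?_)
      hξ hτ).trans_eq (h.heatLine_oddProfile hξ hτ)
    refine (hθ _ _).trans_eq ?_
    rw [show m + r • b 0 + q • b 1 - (m + s • b 0 + q • b 1) = (r - s) • b 0 by
      rw [sub_smul]; abel, norm_smul, b.norm_eq_one, mul_one, Real.norm_eq_abs]
  have hint := hθ.integrable_increment h x y (integrable_heat hτ)
  have hint2 : Integrable (fun p : ℝ × ℝ =>
      (heatLine τ p.1 * (f p.2 (p.1 + ξ / 2) - f p.2 (p.1 - ξ / 2))) * heatLine τ p.2)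
      (volume.prod volume) := by
    have := (hΦ.integrable_comp_emb Φ.measurableEmbedding).2 hint
    refine this.congr (Filter.Eventually.of_forall fun p => ?_)
    simp only [Function.comp, hΦa, heat_coordinates hτ, hf]
    rw [show x + (p.1 • b 0 + p.2 • b 1) = m + (p.1 + ξ / 2) • b 0 + p.2 • b 1 by
      rw [hx, add_smul]; abel, show y + (p.1 • b 0 + p.2 • b 1) =
      m + (p.1 - ξ / 2) • b 0 + p.2 • b 1 by rw [hy, sub_smul, neg_smul]; abel]
    ring
  have heq : ∫ z, (θ (x + z) - θ (y + z)) * heat τ z =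
      ∫ p : ℝ × ℝ, (heatLine τ p.1 * (f p.2 (p.1 + ξ / 2) - f p.2 (p.1 - ξ / 2))) * heatLine τ p.2 := by
    rw [← hΦ.integral_comp Φ.measurableEmbedding]
    congr 1 with p
    simp only [hΦa, heat_coordinates hτ, hf]
    rw [show x + (p.1 • b 0 + p.2 • b 1) = m + (p.1 + ξ / 2) • b 0 + p.2 • b 1 by
      rw [hx, add_smul]; abel, show y + (p.1 • b 0 + p.2 • b 1) =
      m + (p.1 - ξ / 2) • b 0 + p.2 • b 1 by rw [hy, sub_smul, neg_smul]; abel]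
    ring
  rw [heq]
  change ∫ p, _ ∂(volume.prod volume) ≤ _
  rw [integral_prod_symm _ hint2]
  calc _ ≤ ∫ q, C * heatLine τ q := by
        refine integral_mono hint2.integral_prod_right ((integrable_heatLine hτ).const_mul C)
          fun q => ?_
        simp only [integral_mul_const]
        exact mul_le_mul_of_nonneg_right (hline q) (heatLine_nonneg _ _)
    _ = C := by rw [integral_const_mul, integral_heatLine hτ, mul_one]

/-! ### Testing `|D|^α θ` against heat kernels. -/

lemma integrable_weight_shift {θ : Plane → ℝ} (hc : Continuous θ) {β t : ℝ} (hβ : 0 < β)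
    (hβ1 : β < 1) (ht : 0 < t)
    (hθ : Integrable (fun z => θ z * (1 + ‖z‖) ^ (-(2 + 2 * β)))) (x : Plane) :
    Integrable (fun z => θ z * fracHeat β t (z - x)) := by
  obtain ⟨C, hC, hb⟩ := exists_abs_fracHeat_le hβ hβ1 ht
  have hm : Measurable (fun z => fracHeat β t (z - x)) :=
    (measurable_fracHeat β).comp (by fun_prop : Measurable fun z : Plane => (t, z - x))
  refine (hθ.norm.const_mul (C * (1 + ‖x‖) ^ (2 + 2 * β))).mono'
    (hc.aestronglyMeasurable.mul hm.aestronglyMeasurable) (Filter.Eventually.of_forall fun z => ?_)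
  have h1 : (1 + ‖z - x‖) ^ (-(2 + 2 * β)) ≤ (1 + ‖x‖) ^ (2 + 2 * β) * (1 + ‖z‖) ^ (-(2 + 2 * β)) := by
    have h2 : 1 + ‖z‖ ≤ (1 + ‖x‖) * (1 + ‖z - x‖) := by
      have := norm_le_norm_add_norm_sub' z x
      nlinarith [norm_nonneg x, norm_nonneg (z - x), mul_nonneg (norm_nonneg x) (norm_nonneg (z - x))]
    have h3 : ((1 + ‖x‖) * (1 + ‖z - x‖)) ^ (-(2 + 2 * β)) ≤ (1 + ‖z‖) ^ (-(2 + 2 * β)) :=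
      Real.rpow_le_rpow_of_nonpos (by positivity) h2 (by linarith)
    rw [Real.mul_rpow (by positivity) (by positivity)] at h3
    have h4 : (1 + ‖x‖) ^ (2 + 2 * β) * (1 + ‖x‖) ^ (-(2 + 2 * β)) = 1 := by
      rw [← Real.rpow_add (by positivity)]; simp
    calc _ = (1 + ‖x‖) ^ (2 + 2 * β) *
          ((1 + ‖x‖) ^ (-(2 + 2 * β)) * (1 + ‖z - x‖) ^ (-(2 + 2 * β))) := by
          rw [← mul_assoc, h4, one_mul]
      _ ≤ _ := by gcongr
  rw [norm_mul, norm_mul, Real.norm_of_nonneg (by positivity : 0 ≤ (1 + ‖z‖) ^ (-(2 + 2 * β)))]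
  calc ‖θ z‖ * ‖fracHeat β t (z - x)‖ ≤ ‖θ z‖ * (C * ((1 + ‖x‖) ^ (2 + 2 * β) *
        (1 + ‖z‖) ^ (-(2 + 2 * β)))) := by
        gcongr
        exact (hb t le_rfl _).trans (by gcongr)
    _ = _ := by ring

/-- The heat extension of `|D|^α θ` in terms of `θ`. -/
lemma IsFracLap.integral_heat_eq {α : ℝ} (hα : 0 < α) (hα2 : α < 2) {θ g : Plane → ℝ}
    (hg : IsFracLap α θ g) {t : ℝ} (ht : 0 < t) (x : Plane) :
    ∫ z, g z * heat t (z - x) = ∫ z, θ z * fracHeat (α / 2) t (z - x) := by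
  have := hg.integral_eq (heatSchwartz t ht x)
  simp only [fracLapSchwartz_heatSchwartz hα hα2, heatSchwartz_apply, ← Complex.ofReal_mul] at this
  rw [integral_complex_ofReal, integral_complex_ofReal] at this
  exact_mod_cast this.symm

lemma IsFracLap.integrable_mul_heat {α : ℝ} {θ g : Plane → ℝ}
    (hg : IsFracLap α θ g) {t : ℝ} (ht : 0 < t) (x : Plane) :
    Integrable (fun z => g z * heat t (z - x)) := by
  have := hg.integrable_mul (heatSchwartz t ht x)
  simp only [heatSchwartz_apply, ← Complex.ofReal_mul] at this
  simpa using this.re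

/-- Moves the translations from the kernel onto `θ`: the increment `θ (x + z) - θ (y + z)` is
bounded even though `θ` may grow. -/
lemma IsFracLap.integral_heat_sub {α : ℝ} (hα : 0 < α) (hα2 : α < 2) {θ g : Plane → ℝ}
    (hc : Continuous θ) (hg : IsFracLap α θ g) {t : ℝ} (ht : 0 < t) (x y : Plane) :
    (∫ z, g z * heat t (z - x)) - ∫ z, g z * heat t (z - y) =
      ∫ z, (θ (x + z) - θ (y + z)) * fracHeat (α / 2) t z := by
  have hw := hg.integrable_weight
  rw [show 2 + α = 2 + 2 * (α / 2) by ring] at hw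
  have hi := fun p : Plane => (integrable_weight_shift hc (half_pos hα) (by linarith) ht hw p)
  have hs : ∀ p : Plane, ∫ z, θ z * fracHeat (α / 2) t (z - p) =
      ∫ z, θ (p + z) * fracHeat (α / 2) t z := fun p => by
    rw [← integral_add_left_eq_self (fun z => θ z * fracHeat (α / 2) t (z - p)) p]
    simp only [add_sub_cancel_left]
  have hi' : ∀ p : Plane, Integrable (fun z => θ (p + z) * fracHeat (α / 2) t z) := fun p => by
    have := (hi p).comp_add_left p
    simpa only [add_sub_cancel_left] using this
  rw [hg.integral_heat_eq hα hα2 ht, hg.integral_heat_eq hα hα2 ht, hs, hs,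
    ← integral_sub (hi' x) (hi' y)]
  simp only [sub_mul]

/-- The occupation average of increments of the heat extension of `|D|^α θ`. -/
lemma HasModulus.integral_fracHeat_increment {θ : Plane → ℝ} {ω : ℝ → ℝ} (hθ : HasModulus θ ω)
    (h : IsModulus ω) (x y : Plane) {β r ε : ℝ} (hβ : 0 < β) (hβ1 : β < 1) (hr : 0 < r)
    (hε : 0 < ε) :
    IntegrableOn (fun t => t ^ (β - 1) * ∫ z, (θ (x + z) - θ (y + z)) * fracHeat β (t + ε) z)
        (Set.Ioc 0 r) ∧
      IntegrableOn (fun v => overshoot β r v *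
        ∫ z, (θ (x + z) - θ (y + z)) * heat (v + r + ε) z) (Set.Ioi 0) ∧
      ∫ t in Set.Ioc 0 r, t ^ (β - 1) * ∫ z, (θ (x + z) - θ (y + z)) * fracHeat β (t + ε) z =
        Real.Gamma β * (∫ z, (θ (x + z) - θ (y + z)) * heat ε z) -
        r ^ β / Real.Gamma (1 - β) * ∫ v in Set.Ioi 0, overshoot β r v *
          ∫ z, (θ (x + z) - θ (y + z)) * heat (v + r + ε) z := by
  have hc := hθ.continuous h
  set D : Plane → ℝ := fun z => θ (x + z) - θ (y + z) with hD
  have hDc : Continuous D := by fun_prop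
  have hDb : ∀ z, |D z| ≤ ω ‖x - y‖ := hθ.abs_increment_le x y
  have hω0 : 0 ≤ ω ‖x - y‖ := h.nonneg (norm_nonneg _)
  obtain ⟨C, hC, hb⟩ := exists_abs_fracHeat_le hβ hβ1 hε
  have hF : Integrable (fun p : ℝ × Plane => p.1 ^ (β - 1) * (D p.2 * fracHeat β (p.1 + ε) p.2))
      ((volume.restrict (Set.Ioc 0 r)).prod volume) := by
    have hw : Integrable (fun z : Plane => (1 + ‖z‖) ^ (-(2 + 2 * β))) :=
      integrable_one_add_norm (by simp; linarith)
    have hprod := (integrableOn_rpow_Ioc hβ hr).norm.mul_prod (hw.const_mul (ω ‖x - y‖ * C))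
    refine hprod.mono' ?_ ?_
    · have h1 : Measurable (fun p : ℝ × Plane => fracHeat β (p.1 + ε) p.2) :=
        (measurable_fracHeat β).comp (by fun_prop : Measurable fun p : ℝ × Plane => (p.1 + ε, p.2))
      have h2 : Measurable (fun p : ℝ × Plane => D p.2) := hDc.measurable.comp measurable_snd
      have h3 : Measurable (fun p : ℝ × Plane => p.1 ^ (β - 1)) := by fun_prop
      exact (h3.mul (h2.mul h1)).aestronglyMeasurable
    · have : ∀ᵐ p ∂((volume.restrict (Set.Ioc 0 r)).prod (volume : Measure Plane)),
          p.1 ∈ Set.Ioc 0 r :=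
        Measure.quasiMeasurePreserving_fst.ae (ae_restrict_mem measurableSet_Ioc)
      filter_upwards [this] with p hp
      rw [norm_mul, norm_mul, mul_assoc]
      refine mul_le_mul_of_nonneg_left ?_ (norm_nonneg _)
      exact mul_le_mul (hDb _) (hb _ (by linarith [hp.1]) _) (norm_nonneg _) hω0
  have hH : Integrable (fun p : ℝ × Plane => overshoot β r p.1 * (D p.2 * heat (p.1 + r + ε) p.2))
      ((volume.restrict (Set.Ioi 0)).prod volume) := by
    have h1 : Measurable (fun p : ℝ × Plane => heat (p.1 + r + ε) p.2) :=
      measurable_heat.comp (by fun_prop : Measurable fun p : ℝ × Plane => (p.1 + r + ε, p.2))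
    have h2 : Measurable (fun p : ℝ × Plane => D p.2) := hDc.measurable.comp measurable_snd
    have h3 : Measurable (fun p : ℝ × Plane => overshoot β r p.1) :=
      (measurable_overshoot β r).comp measurable_fst
    have hbase : Integrable (fun p : ℝ × Plane => overshoot β r p.1 * heat (p.1 + r + ε) p.2)
        ((volume.restrict (Set.Ioi 0)).prod volume) := by
      have hm : AEStronglyMeasurable
          (fun p : ℝ × Plane => overshoot β r p.1 * heat (p.1 + r + ε) p.2)
          ((volume.restrict (Set.Ioi 0)).prod volume) := (h3.mul h1).aestronglyMeasurable
      refine (integrable_prod_iff hm).2 ⟨?_, ?_⟩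
      · refine (ae_restrict_iff' measurableSet_Ioi).2 (Filter.Eventually.of_forall fun v hv => ?_)
        have hv : 0 < v := hv
        exact (integrable_heat (t := v + r + ε) (by positivity)).const_mul (overshoot β r v)
      · refine Integrable.congr (integrableOn_overshoot hβ hβ1 hr)
          ((ae_restrict_iff' measurableSet_Ioi).2 (Filter.Eventually.of_forall fun v hv => ?_))
        have hv : 0 < v := hv
        simp only [norm_mul]
        rw [integral_const_mul, Real.norm_of_nonneg (overshoot_nonneg hr hv)]
        have : ∀ z, ‖heat (v + r + ε) z‖ = heat (v + r + ε) z := fun z =>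
          Real.norm_of_nonneg (heat_nonneg (by positivity) z)
        simp only [this]
        rw [integral_heat (by positivity), mul_one]
    refine (hbase.norm.const_mul (ω ‖x - y‖)).mono' (h3.mul (h2.mul h1)).aestronglyMeasurable
      (Filter.Eventually.of_forall fun p => ?_)
    rw [norm_mul, norm_mul, norm_mul]
    calc _ ≤ ‖overshoot β r p.1‖ * (ω ‖x - y‖ * ‖heat (p.1 + r + ε) p.2‖) := by
          gcongr
          exact hDb _
      _ = _ := by ring
  have hF2 := hF.integral_prod_left
  have hH2 := hH.integral_prod_left
  have hFs := integral_integral_swap (f := fun t z => t ^ (β - 1) * (D z * fracHeat β (t + ε) z)) hF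
  have hHs := integral_integral_swap (f := fun v z => overshoot β r v * (D z * heat (v + r + ε) z)) hH
  simp only [integral_const_mul] at hF2 hH2 hFs hHs
  refine ⟨hF2, hH2, ?_⟩
  rw [hFs, hHs]
  have hHr := hH.integral_prod_right
  have e1 : ∀ z, ∫ t in Set.Ioc 0 r, t ^ (β - 1) * (D z * fracHeat β (t + ε) z) =
      Real.Gamma β * (D z * heat ε z) - r ^ β / Real.Gamma (1 - β) *
        ∫ v in Set.Ioi 0, overshoot β r v * (D z * heat (v + r + ε) z) := fun z => by
    have key := integral_fracHeat hβ hβ1 hr hε z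
    have e2 : ∀ t : ℝ, t ^ (β - 1) * (D z * fracHeat β (t + ε) z) =
        D z * (t ^ (β - 1) * fracHeat β (t + ε) z) := fun t => by ring
    have e3 : ∀ v : ℝ, overshoot β r v * (D z * heat (v + r + ε) z) =
        D z * (overshoot β r v * heat (v + r + ε) z) := fun v => by ring
    simp_rw [e2, e3]
    rw [integral_const_mul, integral_const_mul, key]
    ring
  simp only [e1]
  rw [integral_sub ((hθ.integrable_increment h x y (integrable_heat hε)).const_mul _)
    (hHr.const_mul _), integral_const_mul, integral_const_mul]

/-! ### From the occupation identity to the jump integral. -/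

/-- The weight `V` averaged over times beyond `a`, against the stable jump density. -/
noncomputable def jumpAverage (β : ℝ) (V : ℝ → ENNReal) (a : ℝ) : ENNReal :=
  ∫⁻ τ in Set.Ioi a, ENNReal.ofReal (τ ^ (-1 - β)) * V τ

lemma rpow_le_overshoot {β h ε v : ℝ} (hβ : 0 < β) (hh : 0 < h) (hε : 0 < ε) (hv : 0 < v) :
    (v + (h + ε)) ^ (-1 - β) ≤ overshoot β h v := by
  have h1 : (v + (h + ε)) ^ (-1 - β) ≤ (v + h) ^ (-1 - β) :=
    Real.rpow_le_rpow_of_nonpos (by positivity) (by linarith) (by linarith)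
  have h2 : (v + h) ^ (-β) ≤ v ^ (-β) :=
    Real.rpow_le_rpow_of_nonpos hv (by linarith) (by linarith)
  have h3 : (v + h) ^ (-1 - β) = (v + h) ^ (-β) * (v + h)⁻¹ := by
    rw [← Real.rpow_neg_one (v + h), ← Real.rpow_add (by positivity)]
    ring_nf
  rw [overshoot]
  refine h1.trans (h3.trans_le ?_)
  gcongr

/-- After the shift `τ = v + h + ε` the overshoot density dominates the jump density. The lower
limit `2h` is free of `ε`, thanks to `ε ≤ h`. -/
lemma jumpAverage_le {β h ε : ℝ} (hβ : 0 < β) (hh : 0 < h) (hε : 0 < ε) (hεh : ε ≤ h)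
    {V : ℝ → ENNReal} {N : ℝ → ℝ} (hV : ∀ τ, 0 < τ → V τ ≤ ENNReal.ofReal (N τ))
    (hN : ∀ τ, 0 < τ → 0 ≤ N τ)
    (hi : IntegrableOn (fun v => overshoot β h v * N (v + h + ε)) (Set.Ioi 0)) :
    jumpAverage β V (2 * h) ≤
      ENNReal.ofReal (∫ v in Set.Ioi 0, overshoot β h v * N (v + h + ε)) := by
  have h1 : jumpAverage β V (2 * h) ≤ jumpAverage β V (h + ε) :=
    lintegral_mono_set (Set.Ioi_subset_Ioi (by linarith))
  have h2 : jumpAverage β V (h + ε) = ∫⁻ v in Set.Ioi 0,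
      ENNReal.ofReal ((v + (h + ε)) ^ (-1 - β)) * V (v + (h + ε)) := by
    have hmp := measurePreserving_add_right (volume : Measure ℝ) (h + ε)
    have := hmp.setLIntegral_comp_preimage_emb (measurableEmbedding_addRight (h + ε))
      (fun τ => ENNReal.ofReal (τ ^ (-1 - β)) * V τ) (Set.Ioi (h + ε))
    rw [jumpAverage, ← this]
    congr 2
    ext v
    simp
  rw [ofReal_integral_eq_lintegral_ofReal hi]
  · refine h1.trans (h2.trans_le (setLIntegral_mono_ae' measurableSet_Ioi
      (Filter.Eventually.of_forall fun v hv => ?_)))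
    have hv : 0 < v := hv
    have hp : 0 < v + h + ε := by positivity
    rw [ENNReal.ofReal_mul (overshoot_nonneg hh hv)]
    refine mul_le_mul' (ENNReal.ofReal_le_ofReal (rpow_le_overshoot hβ hh hε hv)) ?_
    rw [← add_assoc]
    exact hV _ hp
  · refine (ae_restrict_iff' measurableSet_Ioi).2 (Filter.Eventually.of_forall fun v hv => ?_)
    have hv : 0 < v := hv
    exact mul_nonneg (overshoot_nonneg hh hv) (hN _ (by positivity))

lemma integral_rpow_mul_le {β h ε X η : ℝ} (hβ : 0 < β) (hh : 0 < h) {G : ℝ → ℝ}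
    (hG : ∀ t, 0 < t → t ≤ h → |G (t + ε) - X| ≤ η)
    (hi : IntegrableOn (fun t => t ^ (β - 1) * G (t + ε)) (Set.Ioc 0 h)) :
    ∫ t in Set.Ioc 0 h, t ^ (β - 1) * G (t + ε) ≤ (X + η) * (h ^ β / β) := by
  have h1 : ∫ t in Set.Ioc 0 h, t ^ (β - 1) = h ^ β / β := by
    rw [← intervalIntegral.integral_of_le hh.le, integral_rpow (Or.inl (by linarith)),
      sub_add_cancel, Real.zero_rpow hβ.ne', sub_zero]
  rw [mul_comm, ← h1, ← integral_mul_const]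
  refine setIntegral_mono_on hi ((integrableOn_rpow_Ioc hβ hh).mul_const _) measurableSet_Ioc
    fun t ht => ?_
  have := (abs_le.1 (hG t ht.1 ht.2)).2
  have h0 : 0 < t := ht.1
  gcongr
  linarith

/-- The limit of the mean value inequality for the stable subordinator. -/
lemma jumpAverage_le_of_occupation {β X : ℝ} (hβ : 0 < β) (hβ1 : β < 1) {G N : ℝ → ℝ}
    {V : ℝ → ENNReal} (hV : ∀ τ, 0 < τ → V τ ≤ ENNReal.ofReal (N τ)) (hN : ∀ τ, 0 < τ → 0 ≤ N τ)
    (hG : Filter.Tendsto G (nhdsWithin 0 (Set.Ioi 0)) (nhds X))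
    (hN0 : Filter.Tendsto N (nhdsWithin 0 (Set.Ioi 0)) (nhds 0))
    (hGi : ∀ h ε, 0 < h → 0 < ε → IntegrableOn (fun t => t ^ (β - 1) * G (t + ε)) (Set.Ioc 0 h))
    (hNi : ∀ h ε, 0 < h → 0 < ε →
      IntegrableOn (fun v => overshoot β h v * N (v + h + ε)) (Set.Ioi 0))
    (hid : ∀ h ε, 0 < h → 0 < ε → ∫ t in Set.Ioc 0 h, t ^ (β - 1) * G (t + ε) =
      h ^ β / Real.Gamma (1 - β) * (∫ v in Set.Ioi 0, overshoot β h v * N (v + h + ε)) -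
        Real.Gamma β * N ε) :
    0 ≤ X ∧ jumpAverage β V 0 ≤ ENNReal.ofReal (Real.Gamma (1 - β) * X / β) := by
  have hΓ : 0 < Real.Gamma (1 - β) := Real.Gamma_pos_of_pos (by linarith)
  have hΓβ : 0 < Real.Gamma β := Real.Gamma_pos_of_pos hβ
  have step : ∀ η > 0, ∃ h0 > 0, ∀ h, 0 < h → h < h0 → 0 ≤ X + η ∧
      jumpAverage β V (2 * h) ≤ ENNReal.ofReal (Real.Gamma (1 - β) * (X + η) / β) := by
    intro η hη
    obtain ⟨δ, hδ, hδG⟩ : ∃ δ > 0, ∀ t, 0 < t → t < δ → |G t - X| ≤ η / 2 := by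
      have := (Metric.tendsto_nhdsWithin_nhds.1 hG) (η / 2) (by positivity)
      obtain ⟨δ, hδ, hd⟩ := this
      refine ⟨δ, hδ, fun t ht htδ => ?_⟩
      have := hd (x := t) ht (by rw [Real.dist_eq, sub_zero, abs_of_pos ht]; exact htδ)
      rw [Real.dist_eq] at this
      exact this.le
    -- With `t ≤ h` and `ε ≤ h`, the time `t + ε ≤ 2h` stays below `δ`.
    refine ⟨δ / 2, by positivity, fun h hh hhδ => ?_⟩
    have hhβ : 0 < h ^ β := Real.rpow_pos_of_pos hh _
    -- `ε` is chosen after `h`, so that the error `Γ(β) N ε` is small relative to `h ^ β`, the scale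
    -- of the identity.
    obtain ⟨ε, hε, hεh, hNε⟩ : ∃ ε, 0 < ε ∧ ε ≤ h ∧
        Real.Gamma β * N ε ≤ η / 2 * (h ^ β / β) := by
      have h1 := hN0.const_mul (Real.Gamma β)
      rw [mul_zero] at h1
      have h2 := h1.eventually (gt_mem_nhds (by positivity : 0 < η / 2 * (h ^ β / β)))
      have h3 : Set.Ioc (0 : ℝ) h ∈ nhdsWithin (0 : ℝ) (Set.Ioi 0) := Ioc_mem_nhdsGT hh
      obtain ⟨ε, he1, he2⟩ := (h2.and h3).exists
      exact ⟨ε, he2.1, he2.2, le_of_lt he1⟩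
    have hup := integral_rpow_mul_le (ε := ε) (X := X) (η := η / 2) hβ hh
      (fun t ht hth => hδG _ (by positivity) (by linarith)) (hGi h ε hh hε)
    rw [hid h ε hh hε] at hup
    set I := ∫ v in Set.Ioi 0, overshoot β h v * N (v + h + ε) with hI
    have hI0 : 0 ≤ I := setIntegral_nonneg measurableSet_Ioi fun v hv => by
      have hv : 0 < v := hv
      exact mul_nonneg (overshoot_nonneg hh hv) (hN _ (by positivity))
    have hmain : h ^ β / Real.Gamma (1 - β) * I ≤ (X + η) * (h ^ β / β) := by
      have e : (X + η) * (h ^ β / β) = (X + η / 2) * (h ^ β / β) + η / 2 * (h ^ β / β) := by ring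
      linarith
    have hI1 : I ≤ Real.Gamma (1 - β) * (X + η) / β := by
      have e : (X + η) * (h ^ β / β) =
          h ^ β / Real.Gamma (1 - β) * (Real.Gamma (1 - β) * (X + η) / β) := by field_simp
      rw [e] at hmain
      exact le_of_mul_le_mul_left hmain (by positivity)
    refine ⟨?_, ?_⟩
    · have h1 : 0 ≤ Real.Gamma (1 - β) * (X + η) / β := hI0.trans hI1
      rw [mul_div_assoc, mul_nonneg_iff_of_pos_left hΓ, div_nonneg_iff] at h1
      rcases h1 with h1 | h1
      · exact h1.1
      · linarith [h1.2]
    · exact (jumpAverage_le hβ hh hε hεh hV hN (hNi h ε hh hε)).trans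
        (ENNReal.ofReal_le_ofReal hI1)
  have hX : 0 ≤ X := by
    refine le_of_forall_pos_le_add fun η hη => ?_
    obtain ⟨h0, hh0, hs⟩ := step η hη
    exact (hs (h0 / 2) (by positivity) (by linarith)).1
  refine ⟨hX, ?_⟩
  have hη : ∀ η > 0, jumpAverage β V 0 ≤ ENNReal.ofReal (Real.Gamma (1 - β) * (X + η) / β) := by
    intro η hη
    obtain ⟨h0, hh0, hs⟩ := step η hη
    -- Monotone convergence as the level tends to zero, with `2h = h0 / (n + 1)`.
    have hU : Set.Ioi (0 : ℝ) = ⋃ n : ℕ, Set.Ioi (h0 / (n + 1)) := by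
      ext τ
      simp only [Set.mem_Ioi, Set.mem_iUnion]
      constructor
      · intro hτ
        obtain ⟨n, hn⟩ := exists_nat_gt (h0 / τ)
        refine ⟨n, ?_⟩
        rw [div_lt_iff₀ (by positivity)]
        rw [div_lt_iff₀ hτ] at hn
        nlinarith
      · rintro ⟨n, hn⟩
        exact lt_trans (by positivity) hn
    have hmono : Monotone fun n : ℕ => Set.Ioi (h0 / ((n : ℝ) + 1)) := fun m n hmn => by
      apply Set.Ioi_subset_Ioi
      have : (m : ℝ) ≤ n := by exact_mod_cast hmn
      gcongr
    rw [jumpAverage, hU, setLIntegral_iUnion_of_directed _ hmono.directed_le]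
    refine iSup_le fun n => ?_
    have := (hs (h0 / (n + 1) / 2) (by positivity) ?_).2
    · rwa [mul_div_cancel₀ _ two_ne_zero] at this
    · have : h0 / ((n : ℝ) + 1) ≤ h0 := div_le_self hh0.le (by linarith [n.cast_nonneg (α := ℝ)])
      linarith
  have hlim : Filter.Tendsto (fun η => ENNReal.ofReal (Real.Gamma (1 - β) * (X + η) / β))
      (nhdsWithin 0 (Set.Ioi 0)) (nhds (ENNReal.ofReal (Real.Gamma (1 - β) * (X + 0) / β))) := by
    have hc : Continuous (fun η => ENNReal.ofReal (Real.Gamma (1 - β) * (X + η) / β)) :=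
      ENNReal.continuous_ofReal.comp (by fun_prop)
    exact (hc.tendsto 0).mono_left nhdsWithin_le_nhds
  rw [add_zero] at hlim
  exact ge_of_tendsto hlim (by filter_upwards [self_mem_nhdsWithin] with η h using hη η h)

/-! ### Time averaging and the final estimate. -/

/-- Averaging over time turns the Gaussian weights into the power `u ^ (-1 - α)`. -/
lemma IsModulus.jumpAverage_gap {ω : ℝ → ℝ} (h : IsModulus ω) {ξ β : ℝ} (hξ : 0 < ξ) (hβ : 0 < β)
    (hβ1 : β < 1) :
    jumpAverage β (fun τ => ENNReal.ofReal
      (-∫ u in Set.Ioi 0, heatLine τ u * modulusGap ω ξ u)) 0 =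
      ∫⁻ u in Set.Ioi 0, ENNReal.ofReal
        (timeConst β * -(modulusGap ω ξ u / u ^ (1 + 2 * β))) := by
  set Γ' : ℝ → ℝ := (Set.Ioi 0).indicator (modulusGap ω ξ) with hΓ'
  have hm : Measurable Γ' := h.measurable_modulusGap_indicator hξ
  have heq : ∀ u ∈ Set.Ioi (0 : ℝ), Γ' u = modulusGap ω ξ u := fun u hu =>
    Set.indicator_of_mem hu _
  have hnp : ∀ u ∈ Set.Ioi (0 : ℝ), 0 ≤ -Γ' u := fun u hu => by
    rw [heq u hu, neg_nonneg]
    exact h.modulusGap_nonpos hξ (le_of_lt hu)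
  have h1 : ∀ τ ∈ Set.Ioi (0 : ℝ), ENNReal.ofReal (τ ^ (-1 - β)) * ENNReal.ofReal
      (-∫ u in Set.Ioi 0, heatLine τ u * modulusGap ω ξ u) =
      ∫⁻ u in Set.Ioi 0, ENNReal.ofReal (τ ^ (-1 - β) * heatLine τ u) * ENNReal.ofReal (-Γ' u) :=
    fun τ hτ => by
      have hτ : 0 < τ := hτ
      have hi := (h.integrableOn_heatLine_gap hξ hτ).neg
      rw [← ENNReal.ofReal_mul (by positivity), ← integral_neg, ← integral_const_mul,
        ofReal_integral_eq_lintegral_ofReal]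
      · refine setLIntegral_congr_fun measurableSet_Ioi fun u hu => ?_
        rw [← ENNReal.ofReal_mul (mul_nonneg (by positivity) (heatLine_nonneg _ _)), heq u hu]
        congr 1
        ring
      · exact hi.const_mul _
      · refine (ae_restrict_iff' measurableSet_Ioi).2 (Filter.Eventually.of_forall fun u hu => ?_)
        have h2 := hnp u hu
        rw [heq u hu] at h2
        have h3 := heatLine_nonneg τ u
        have : 0 ≤ heatLine τ u * -modulusGap ω ξ u := mul_nonneg h3 h2
        simp only [Pi.zero_apply]
        rw [← mul_neg]
        positivity
  -- Tonelli in `ENNReal`: finiteness is not yet known and will follow from the estimate.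
  rw [jumpAverage, setLIntegral_congr_fun measurableSet_Ioi h1, lintegral_lintegral_swap]
  · refine setLIntegral_congr_fun measurableSet_Ioi fun u hu => ?_
    have hu0 : 0 < u := hu
    have hmu : Measurable (fun τ => ENNReal.ofReal (τ ^ (-1 - β) * heatLine τ u)) := by
      have : Measurable (fun τ => heatLine τ u) :=
        measurable_heatLine.comp (by fun_prop : Measurable fun τ : ℝ => (τ, u))
      fun_prop
    rw [lintegral_mul_const _ hmu, lintegral_timeKernel hβ hβ1 hu0,
      ← ENNReal.ofReal_mul (mul_nonneg (timeConst_pos hβ hβ1).le (by positivity)), heq u hu,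
      Real.rpow_neg hu0.le]
    congr 1
    field_simp
  · have h2 : Measurable (fun p : ℝ × ℝ => p.1 ^ (-1 - β) * heatLine p.1 p.2) :=
      Measurable.mul (by fun_prop) measurable_heatLine
    have h3 : Measurable (fun p : ℝ × ℝ => -Γ' p.2) := (hm.comp measurable_snd).neg
    exact (h2.ennreal_ofReal.mul h3.ennreal_ofReal).aemeasurable

/-- The pointwise estimate in terms of the measure-theoretic average of the modulus gap. -/
lemma IsFracLap.lintegral_gap_le {α : ℝ} (hα₀ : 0 < α) (hα₂ : α < 2) {ω : ℝ → ℝ}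
    {θ g : Plane → ℝ} {x y : Plane} {ξ : ℝ} (h : IsModulus ω) (hθ : HasModulus θ ω)
    (hg : IsFracLap α θ g) (hgx : ContinuousAt g x) (hgy : ContinuousAt g y)
    (hxy : ‖x - y‖ = ξ) (hξ : 0 < ξ) (hmax : θ x - θ y = ω ξ) :
    0 ≤ g x - g y ∧
      ∫⁻ u in Set.Ioi 0, ENNReal.ofReal
        (timeConst (α / 2) * -(modulusGap ω ξ u / u ^ (1 + α))) ≤
        ENNReal.ofReal (Real.Gamma (1 - α / 2) * (g x - g y) / (α / 2)) := by
  have hβ : 0 < α / 2 := half_pos hα₀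
  have hβ1 : α / 2 < 1 := by linarith
  have hc := hθ.continuous h
  have key := h.jumpAverage_gap hξ hβ hβ1
  rw [show 1 + 2 * (α / 2) = 1 + α by ring] at key
  rw [← key]
  set m : ℝ → ℝ := fun τ => ∫ z, (θ (x + z) - θ (y + z)) * heat τ z with hm
  have hGeq : ∀ h ε : ℝ, 0 < ε → ∀ t ∈ Set.Ioc 0 h,
      t ^ (α / 2 - 1) * (∫ z, (θ (x + z) - θ (y + z)) * fracHeat (α / 2) (t + ε) z) =
      t ^ (α / 2 - 1) * ((∫ z, g z * heat (t + ε) (z - x)) - ∫ z, g z * heat (t + ε) (z - y)) :=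
    fun h ε hε t ht => by
      rw [hg.integral_heat_sub hα₀ hα₂ hc (by linarith [ht.1]) x y]
  have hNsplit : ∀ h ε v : ℝ, overshoot (α / 2) h v * (ω ξ - m (v + h + ε)) =
      overshoot (α / 2) h v * ω ξ - overshoot (α / 2) h v * m (v + h + ε) := fun h ε v => by ring
  -- `N` is the deficit of the heat-averaged increment from its maximum. It tends to zero because
  -- the increment equals `ω ξ` at time zero.
  refine jumpAverage_le_of_occupation (N := fun τ => ω ξ - m τ)
    (G := fun t => (∫ z, g z * heat t (z - x)) - ∫ z, g z * heat t (z - y)) hβ hβ1 ?_ ?_ ?_ ?_ ?_ ?_ ?_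
  · intro τ hτ
    refine ENNReal.ofReal_le_ofReal ?_
    have := hθ.integral_increment_heat_le h hxy hξ hτ
    simp only [hm]
    linarith
  · intro τ hτ
    have h1 := hθ.integral_increment_heat_le h hxy hξ hτ
    have h2 : ∫ u in Set.Ioi 0, heatLine τ u * modulusGap ω ξ u ≤ 0 :=
      setIntegral_nonpos measurableSet_Ioi fun u hu =>
        mul_nonpos_of_nonneg_of_nonpos (heatLine_nonneg _ _)
          (h.modulusGap_nonpos hξ (le_of_lt hu))
    simp only [hm]
    linarith
  · exact (tendsto_integral_heat (hg.integrable_mul_heat one_pos x) hgx).sub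
      (tendsto_integral_heat (hg.integrable_mul_heat one_pos y) hgy)
  · have h1 := tendsto_integral_heat_zero (f := fun z => θ (x + z) - θ (y + z))
      (hθ.integrable_increment h x y (integrable_heat one_pos))
      (by fun_prop : Continuous fun z => θ (x + z) - θ (y + z)).continuousAt
    simp only [add_zero, hmax] at h1
    have := h1.const_sub (ω ξ)
    rwa [sub_self] at this
  · intro r ε hr hε
    exact (hθ.integral_fracHeat_increment h x y hβ hβ1 hr hε).1.congr_fun (hGeq r ε hε)
      measurableSet_Ioc
  · intro r ε hr hε
    simp only [hNsplit]
    exact ((integrableOn_overshoot hβ hβ1 hr).mul_const _).sub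
      (hθ.integral_fracHeat_increment h x y hβ hβ1 hr hε).2.1
  · intro r ε hr hε
    obtain ⟨-, hi, he⟩ := hθ.integral_fracHeat_increment h x y hβ hβ1 hr hε
    rw [setIntegral_congr_fun measurableSet_Ioc (hGeq r ε hε)] at he
    simp only [hNsplit]
    rw [he, integral_sub ((integrableOn_overshoot hβ hβ1 hr).mul_const _) hi, integral_mul_const]
    -- Replacing the increment by the deficit adds `ω ξ` against both terms; the total overshoot
    -- mass `Γ(β)` makes these contributions cancel.
    have hmass := overshoot_mass hβ hβ1 hr
    linear_combination -ω ξ * hmass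

theorem lemma3p3 (α : ℝ) (hα₀ : 0 < α) (hα₂ : α < 2) :
    ∃ B : ℝ, 0 < B ∧
      ∀ (ω : ℝ → ℝ) (θ g : EuclideanSpace ℝ (Fin 2) → ℝ) (x y : EuclideanSpace ℝ (Fin 2)) (ξ : ℝ),
        IsModulus ω → HasModulus θ ω →
        IsFracLap α θ g → ContinuousAt g x → ContinuousAt g y →
        ‖x - y‖ = ξ → 0 < ξ → θ x - θ y = ω ξ →
        IntegrableOn (nearIntegrand α ω ξ) (Set.Ioo 0 (ξ / 2)) volume ∧
        IntegrableOn (farIntegrand α ω ξ) (Set.Ioi (ξ / 2)) volume ∧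
        (-g x) - (-g y) ≤
          B * (∫ η in Set.Ioo 0 (ξ / 2), nearIntegrand α ω ξ η) +
          B * (∫ η in Set.Ioi (ξ / 2), farIntegrand α ω ξ η) ∧
        (∫ η in Set.Ioo 0 (ξ / 2), nearIntegrand α ω ξ η) ≤ 0 ∧
        (∫ η in Set.Ioi (ξ / 2), farIntegrand α ω ξ η) ≤ 0 ∧
        ((∃ s ∈ Set.Icc 0 (2 * ξ), ω s ≠ ω ξ / ξ * s) →
          (∫ η in Set.Ioo 0 (ξ / 2), nearIntegrand α ω ξ η) < 0) ∧
        ((∃ s ∈ Set.Ici (0 : ℝ), ω s ≠ ω ξ / ξ * s) →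
          (∫ η in Set.Ioi (ξ / 2), farIntegrand α ω ξ η) < 0) := by
  have hβ : 0 < α / 2 := half_pos hα₀
  have hβ1 : α / 2 < 1 := by linarith
  have hT := timeConst_pos hβ hβ1
  have hΓ : 0 < Real.Gamma (1 - α / 2) := Real.Gamma_pos_of_pos (by linarith)
  -- `timeConst` comes from averaging the Gaussian in time, and `β / Γ(1 - β)` from solving the
  -- limiting occupation bound for `g x - g y`.
  refine ⟨α / 2 * timeConst (α / 2) / Real.Gamma (1 - α / 2), by positivity, ?_⟩
  intro ω θ g x y ξ h hθ hg hgx hgy hxy hξ hmax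
  obtain ⟨hX, hle⟩ := hg.lintegral_gap_le hα₀ hα₂ h hθ hgx hgy hxy hξ hmax
  set f : ℝ → ℝ := fun u => modulusGap ω ξ u / u ^ (1 + α) with hf
  have hf0 : ∀ u ∈ Set.Ioi (0 : ℝ), f u ≤ 0 := fun u hu =>
    div_nonpos_of_nonpos_of_nonneg (h.modulusGap_nonpos hξ (le_of_lt hu))
      (Real.rpow_nonneg (le_of_lt hu) _)
  have hfm : AEStronglyMeasurable f (volume.restrict (Set.Ioi 0)) :=
    (h.continuousOn_gap_div hξ α).aestronglyMeasurable measurableSet_Ioi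
  have hpos : 0 ≤ᵐ[volume.restrict (Set.Ioi 0)] fun u => timeConst (α / 2) * -f u :=
    (ae_restrict_iff' measurableSet_Ioi).2 (Filter.Eventually.of_forall fun u hu =>
      mul_nonneg hT.le (neg_nonneg.2 (hf0 u hu)))
  -- The integrand has constant sign, so the finite `lintegral` bound already is absolute
  -- convergence.
  have hTi : IntegrableOn (fun u => timeConst (α / 2) * -f u) (Set.Ioi 0) := by
    refine ⟨hfm.neg.const_mul _, ?_⟩
    rw [hasFiniteIntegral_iff_ofReal hpos]
    exact hle.trans_lt ENNReal.ofReal_lt_top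
  have hfi : IntegrableOn f (Set.Ioi 0) := by
    have := hTi.const_mul (-(timeConst (α / 2))⁻¹)
    refine IntegrableOn.congr_fun this (fun u _ => ?_) measurableSet_Ioi
    field_simp
  have hbound : timeConst (α / 2) * -(∫ u in Set.Ioi 0, f u) ≤
      Real.Gamma (1 - α / 2) * (g x - g y) / (α / 2) := by
    rw [← ofReal_integral_eq_lintegral_ofReal hTi hpos,
      ENNReal.ofReal_le_ofReal_iff (by positivity), integral_const_mul, integral_neg] at hle
    exact hle
  have hnear : ∀ u ∈ Set.Ioo 0 (ξ / 2), f u = nearIntegrand α ω ξ u := fun u hu =>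
    (nearIntegrand_eq α ω ξ hu).symm
  have hfar : ∀ u ∈ Set.Ioi (ξ / 2), f u = farIntegrand α ω ξ u := fun u hu =>
    (farIntegrand_eq α ω ξ hu).symm
  have hsub : Set.Ioi (ξ / 2) ⊆ Set.Ioi 0 := Set.Ioi_subset_Ioi (by positivity)
  have hi1 : IntegrableOn (nearIntegrand α ω ξ) (Set.Ioo 0 (ξ / 2)) :=
    (hfi.mono_set Set.Ioo_subset_Ioi_self).congr_fun hnear measurableSet_Ioo
  have hi2 : IntegrableOn (farIntegrand α ω ξ) (Set.Ioi (ξ / 2)) :=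
    (hfi.mono_set hsub).congr_fun hfar measurableSet_Ioi
  have hsplit : ∫ u in Set.Ioi 0, f u = (∫ η in Set.Ioo 0 (ξ / 2), nearIntegrand α ω ξ η) +
      ∫ η in Set.Ioi (ξ / 2), farIntegrand α ω ξ η := by
    rw [← setIntegral_congr_fun measurableSet_Ioo hnear,
      ← setIntegral_congr_fun measurableSet_Ioi hfar, ← integral_Ioc_eq_integral_Ioo,
      ← setIntegral_union (Set.Ioc_disjoint_Ioi le_rfl) measurableSet_Ioi
        (hfi.mono_set Set.Ioc_subset_Ioi_self) (hfi.mono_set hsub),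
      Set.Ioc_union_Ioi_eq_Ioi (by positivity)]
  refine ⟨hi1, hi2, ?_, ?_, ?_, h.near_neg hξ hi1, h.far_neg hξ hi2⟩
  · rw [← mul_add, ← hsplit]
    have e : α / 2 * timeConst (α / 2) / Real.Gamma (1 - α / 2) * (∫ u in Set.Ioi 0, f u) =
        -(α / 2 / Real.Gamma (1 - α / 2) * (timeConst (α / 2) * -(∫ u in Set.Ioi 0, f u))) := by
      ring
    have e2 : ∀ c : ℝ, 0 < c → g x - g y = α / 2 / c * (c * (g x - g y) / (α / 2)) :=
      fun c hc => by field_simp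
    have := mul_le_mul_of_nonneg_left hbound
      (by positivity : 0 ≤ α / 2 / Real.Gamma (1 - α / 2))
    rw [← e2 _ hΓ] at this
    rw [e]
    linarith
  · rw [← setIntegral_congr_fun measurableSet_Ioo hnear]
    exact setIntegral_nonpos measurableSet_Ioo fun u hu => hf0 u hu.1
  · rw [← setIntegral_congr_fun measurableSet_Ioi hfar]
    exact setIntegral_nonpos measurableSet_Ioi fun u hu => hf0 u (hsub hu)
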